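/- A qubit dynamical map is a family $(\Lambda_t)_{t\ge 0}$ of completely positive trace-preserving (CPTP) linear maps $\Lambda_t: M_2(\mathbb{C})\to M_2(\mathbb{C})$, continuous in $t$, with $\Lambda_0=\mathrm{id}$; neither invertibility of the $\Lambda_t$ nor $\mathrm{Im}(\Lambda_t)\subseteq \mathrm{Im}(\Lambda_s)$ for $t>s$ (image non-increase) is assumed. It is called CP-divisible if for all $0\le s\le t$ there is a CPTP linear map $V_{t,s}: M_2(\mathbb{C})\to M_2(\mathbb{C})$, defined on the whole of $M_2(\mathbb{C})$, such that $\Lambda_t=V_{t,s}\circ\Lambda_s$. Let $\|A\|_1=\mathrm{Tr}\sqrt{AA^\dagger}$ denote the trace norm. Then a qubit dynamical map $\Lambda_t$ is CP-divisible if and only if $$\frac{d}{dt}\,\bigl\|[\mathrm{id}_2\otimes\Lambda_t](p_1\varrho_1-p_2\varrho_2)\bigr\|_1\le 0$$ for all $t\ge 0$, all probabilities $p_1,p_2\ge 0$ with $p_1+p_2=1$, and all two-qubit density operators $\varrho_1,\varrho_2$ on $\mathbb{C}^2\otimes\mathbb{C}^2$. Here, since the trace norm need not be differentiable along the evolution,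 $\frac{d}{dt}f(t)$ denotes the upper forward derivative $\limsup_{h\to0^+}\frac{f(t+h)-f(t)}{h}\in[-\infty,\infty]$, which equals the ordinary (or right) derivative wherever that exists. -/

import Mathlib

open scoped MatrixOrder ComplexOrder

namespace QubitEvolution

/-- `M₂(ℂ)`, the linear operators on the qubit space `ℂ²`. -/
abbrev M2 := Matrix (Fin 2) (Fin 2) ℂ

/-- `id_k ⊗ Φ`: the map `Φ` is applied to every block of the block matrix `A` (the first index of a
pair is the ancilla, the second one the system). -/
def ampliation {n : Type*} (κ : Type*) (Φ : Matrix n n ℂ →ₗ[ℂ] Matrix n n ℂ)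
    (A : Matrix (κ × n) (κ × n) ℂ) : Matrix (κ × n) (κ × n) ℂ :=
  Matrix.of fun x y => Φ (Matrix.of fun a b => A (x.1, a) (y.1, b)) x.2 y.2

/-- Completely positive: `id_k ⊗ Φ` preserves positive semidefiniteness for every `k`. -/
def IsCompletelyPositive {n : Type*} (Φ : Matrix n n ℂ →ₗ[ℂ] Matrix n n ℂ) : Prop :=
  ∀ (k : ℕ) (A : Matrix (Fin k × n) (Fin k × n) ℂ),
    A.PosSemidef → (ampliation (Fin k) Φ A).PosSemidef

/-- Completely positive and trace preserving (a quantum channel). -/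
def IsCPTP {n : Type*} [Fintype n] (Φ : Matrix n n ℂ →ₗ[ℂ] Matrix n n ℂ) : Prop :=
  IsCompletelyPositive Φ ∧ ∀ A : Matrix n n ℂ, (Φ A).trace = A.trace

/-- Density operators: positive semidefinite with unit trace. -/
def IsDensity {n : Type*} [Fintype n] (ρ : Matrix n n ℂ) : Prop :=
  ρ.PosSemidef ∧ ρ.trace = 1

/-- The trace norm `‖A‖₁ = Tr √(A A†)`. -/
noncomputable def traceNorm {n : Type*} [Fintype n] [DecidableEq n] (A : Matrix n n ℂ) : ℝ :=
  (CFC.sqrt (A * A.conjTranspose)).trace.re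

/-- A qubit dynamical map: a continuous family `Λ t`, `t ≥ 0`, of completely positive trace
preserving maps with `Λ 0 = id`. Values at `t < 0` are irrelevant. Continuity is stated pointwise,
which in finite dimension is the same as continuity in norm. -/
structure IsQubitDynamicalMap (Λ : ℝ → M2 →ₗ[ℂ] M2) : Prop where
  cptp : ∀ t, 0 ≤ t → IsCPTP (Λ t)
  init : Λ 0 = LinearMap.id
  cont : ∀ X : M2, ContinuousOn (fun t => Λ t X) (Set.Ici 0)

/-- CP-divisible: for all `0 ≤ s ≤ t` there is a channel `V_{t,s}` on the whole of `M₂(ℂ)` with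
`Λ_t = V_{t,s} ∘ Λ_s`. -/
def IsCPDivisible (Λ : ℝ → M2 →ₗ[ℂ] M2) : Prop :=
  ∀ s t, 0 ≤ s → s ≤ t → ∃ V : M2 →ₗ[ℂ] M2, IsCPTP V ∧ Λ t = V ∘ₗ Λ s

/-- The forward time derivative
`limsup_{h → 0+} (f (t + h) - f t) / h`, with values in `[-∞, ∞]`. It is the usual derivative
(or right derivative) at `t` whenever that exists; it is used because the trace norm has kinks. -/
noncomputable def forwardDeriv (f : ℝ → ℝ) (t : ℝ) : EReal :=
  Filter.limsup (fun h : ℝ => (((f (t + h) - f t) / h : ℝ) : EReal)) (nhdsWithin 0 (Set.Ioi 0))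

end QubitEvolution

namespace QubitEvolution
open Matrix

/-! ### Trace norm of Hermitian matrices. -/

section TraceNorm

variable {n : Type*} [Fintype n] [DecidableEq n]

/-! A channel tensored with the identity contracts the trace norm
(`IsCPTP.traceNorm_ampliation_le`), which gives the forward direction. Conversely, every two-qubit
Hermitian matrix is a nonnegative multiple of some p₁ϱ₁ - p₂ϱ₂, so nonpositive forward derivatives
make the norm of the ampliated evolution nonincreasing on all Hermitian matrices. For s ≤ t a
channel V with Λ_t = V ∘ Λ_s must then be produced.

If Λ_s is injective, V = Λ_t ∘ Λ_s⁻¹ is trace preserving and does not increase the norm of the Choi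
matrix of the identity; a Hermitian matrix whose trace norm is at most its trace is positive, so the
Choi matrix of V is positive (`exists_channel_of_injective`).

Otherwise Λ_s has rank at most two (`finrank_range_le_two`). At the first noninjective time t₀, a
limit of the channels V_{t₀,r} as r ↑ t₀ is a channel projecting onto the image of Λ_{t₀}, and no
such projection has rank three (`finrank_range_ne_three`). After t₀ the kernel never shrinks below
that of Λ_{t₀}.

In rank at most two, either Λ_s is constant on states and a replacement channel works, or its image
is spanned by two pure states, found where the line through two image states meets the zero set of
the determinant. For two pure inputs, norm contractivity says exactly enough about fidelities to
build V (`exists_channel_of_pure`, resting on `exists_block`). Contractivity forces ker Λ_s ≤ ker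
Λ_t, so matching two spanning values is enough (`exists_channel_of_finrank_le_two`). -/

lemma traceNorm_eq_abs {A : Matrix n n ℂ} (hA : A.IsHermitian) :
    traceNorm A = (CFC.abs A).trace.re := by
  unfold traceNorm CFC.abs
  rw [hA.eq, star_eq_conjTranspose, hA.eq]

lemma traceNorm_of_posSemidef {A : Matrix n n ℂ} (hA : A.PosSemidef) :
    traceNorm A = A.trace.re := by
  rw [traceNorm_eq_abs hA.isHermitian, CFC.abs_of_nonneg A hA.nonneg]

/-- The Jordan decomposition of a Hermitian matrix. -/
lemma exists_jordan {A : Matrix n n ℂ} (hA : A.IsHermitian) :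
    ∃ P Q : Matrix n n ℂ, P.PosSemidef ∧ Q.PosSemidef ∧ A = P - Q ∧
      traceNorm A = P.trace.re + Q.trace.re := by
  have hs : IsSelfAdjoint A := hA
  refine ⟨A⁺, A⁻, nonneg_iff_posSemidef.1 (CFC.posPart_nonneg A),
    nonneg_iff_posSemidef.1 (CFC.negPart_nonneg A), (CFC.posPart_sub_negPart A hs).symm, ?_⟩
  rw [traceNorm_eq_abs hA, ← CFC.posPart_add_negPart A hs, trace_add, Complex.add_re]

lemma traceNorm_eq_sum_eigenvalues {A : Matrix n n ℂ} (hA : A.IsHermitian) :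
    traceNorm A = ∑ i, |hA.eigenvalues i| := by
  have hs : IsSelfAdjoint A := hA
  rw [traceNorm_eq_abs hA, CFC.abs_eq_cfc_norm A hs, hA.cfc_eq, IsHermitian.cfc,
    Unitary.conjStarAlgAut_apply, trace_mul_cycle, Unitary.coe_star_mul_self, one_mul, trace_diagonal]
  simp

/-- In an eigenbasis of P - Q each eigenvalue is the difference of the nonnegative diagonal entries
of P and Q, so its modulus is at most their sum. -/
lemma traceNorm_sub_le {P Q : Matrix n n ℂ} (hP : P.PosSemidef) (hQ : Q.PosSemidef) :
    traceNorm (P - Q) ≤ P.trace.re + Q.trace.re := by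
  have hA : (P - Q).IsHermitian := hP.isHermitian.sub hQ.isHermitian
  rw [traceNorm_eq_sum_eigenvalues hA]
  set U := (hA.eigenvectorUnitary : Matrix n n ℂ) with hU
  have hUU : U * Uᴴ = 1 := Unitary.coe_mul_star_self hA.eigenvectorUnitary
  have hUU' : Uᴴ * U = 1 := Unitary.coe_star_mul_self hA.eigenvectorUnitary
  have hD : Uᴴ * P * U - Uᴴ * Q * U = diagonal (fun i => (hA.eigenvalues i : ℂ)) := by
    have h := hA.spectral_theorem
    rw [Unitary.conjStarAlgAut_apply] at h
    rw [← sub_mul, ← mul_sub]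
    calc Uᴴ * (P - Q) * U = Uᴴ * (U * diagonal (RCLike.ofReal ∘ hA.eigenvalues) * Uᴴ) * U :=
          congrArg (fun X => Uᴴ * X * U) h
      _ = Uᴴ * U * diagonal (RCLike.ofReal ∘ hA.eigenvalues) * (Uᴴ * U) := by
          simp only [mul_assoc]
      _ = _ := by rw [hUU', one_mul, mul_one]; rfl
  have hP' := hP.conjTranspose_mul_mul_same U
  have hQ' := hQ.conjTranspose_mul_mul_same U
  have key : ∀ i, |hA.eigenvalues i| ≤ ((Uᴴ * P * U) i i).re + ((Uᴴ * Q * U) i i).re := by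
    intro i
    have h1 := (Complex.le_def.1 (hP'.diag_nonneg (i := i))).1
    have h2 := (Complex.le_def.1 (hQ'.diag_nonneg (i := i))).1
    have h3 := congrArg Complex.re (congrFun (congrFun hD i) i)
    simp only [Matrix.sub_apply, diagonal_apply_eq, Complex.sub_re, Complex.ofReal_re] at h3
    simp only [Complex.zero_re] at h1 h2
    rw [abs_le]; constructor <;> linarith
  calc ∑ i, |hA.eigenvalues i|
      ≤ ∑ i, (((Uᴴ * P * U) i i).re + ((Uᴴ * Q * U) i i).re) := Finset.sum_le_sum fun i _ => key i
    _ = (Uᴴ * P * U).trace.re + (Uᴴ * Q * U).trace.re := by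
        simp [trace, Finset.sum_add_distrib]
    _ = P.trace.re + Q.trace.re := by
        rw [trace_mul_cycle, hUU, one_mul, trace_mul_cycle, hUU, one_mul]

/-- With the Jordan decomposition P - Q, the norm exceeds the trace by twice the trace of Q, which
must therefore vanish. This is how norm bounds become positivity. -/
lemma posSemidef_of_traceNorm_le {A : Matrix n n ℂ} (hA : A.IsHermitian)
    (h : traceNorm A ≤ A.trace.re) : A.PosSemidef := by
  obtain ⟨P, Q, hP, hQ, rfl, h'⟩ := exists_jordan hA
  rw [h', trace_sub, Complex.sub_re] at h
  have h1 := Complex.le_def.1 hQ.trace_nonneg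
  have h0 : Q.trace = 0 := by
    apply Complex.ext
    · have := h1.1; simp at this ⊢; linarith
    · exact h1.2.symm
  rw [hQ.trace_eq_zero_iff.1 h0, sub_zero]
  exact hP

lemma traceNorm_nonneg (A : Matrix n n ℂ) : 0 ≤ traceNorm A :=
  (Complex.le_def.1 (nonneg_iff_posSemidef.1 (CFC.sqrt_nonneg (A * Aᴴ))).trace_nonneg).1

@[simp] lemma traceNorm_zero : traceNorm (0 : Matrix n n ℂ) = 0 := by
  rw [traceNorm_of_posSemidef PosSemidef.zero]; simp

lemma eq_zero_of_traceNorm_le_zero {A : Matrix n n ℂ} (hA : A.IsHermitian)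
    (h : traceNorm A ≤ 0) : A = 0 := by
  obtain ⟨P, Q, hP, hQ, rfl, h'⟩ := exists_jordan hA
  have h1 := Complex.le_def.1 hQ.trace_nonneg
  have h2 := Complex.le_def.1 hP.trace_nonneg
  have h3 := h1.1
  have h4 := h2.1
  simp only [Complex.zero_re] at h3 h4
  rw [hQ.trace_eq_zero_iff.1 (Complex.ext (by simp; linarith) h1.2.symm),
    hP.trace_eq_zero_iff.1 (Complex.ext (by simp; linarith) h2.2.symm), sub_zero]

lemma traceNorm_smul {A : Matrix n n ℂ} (hA : A.IsHermitian) {r : ℝ} (hr : 0 ≤ r) :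
    traceNorm ((r : ℂ) • A) = r * traceNorm A := by
  have h : ((r : ℂ) • A).IsHermitian := by
    rw [IsHermitian, conjTranspose_smul, hA.eq]; simp
  rw [traceNorm_eq_abs h, traceNorm_eq_abs hA, CFC.abs_smul, trace_smul]
  simp [abs_of_nonneg hr]

open scoped Matrix.Norms.L2Operator in
lemma continuous_trace_abs :
    Continuous fun A : Matrix n n ℂ => (CFC.abs A).trace.re :=
  Complex.continuous_re.comp (CFC.continuous_abs.matrix_trace)

/-- The square of the trace norm of a Hermitian `2 × 2` matrix. -/
lemma traceNorm_sq {A : M2} (hA : A.IsHermitian) :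
    traceNorm A ^ 2 = A.trace.re ^ 2 - 2 * A.det.re + 2 * |A.det.re| := by
  have h0 := traceNorm_eq_sum_eigenvalues hA
  have h1 := hA.trace_eq_sum_eigenvalues
  have h2 := hA.det_eq_prod_eigenvalues
  rw [Fin.sum_univ_two] at h0 h1
  rw [Fin.prod_univ_two] at h2
  have h1' : A.trace.re = hA.eigenvalues 0 + hA.eigenvalues 1 := by rw [h1]; simp
  have h2' : A.det.re = hA.eigenvalues 0 * hA.eigenvalues 1 := by rw [h2]; simp
  rw [h0, h1', h2', abs_mul, add_sq, sq_abs, sq_abs]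
  ring

end TraceNorm
end QubitEvolution

namespace QubitEvolution
open Matrix
open scoped Kronecker

/-! ### Algebra of id ⊗ Φ. -/

section Ampliation

variable {n κ : Type*}

lemma ampliation_sub (Φ : Matrix n n ℂ →ₗ[ℂ] Matrix n n ℂ) (A B : Matrix (κ × n) (κ × n) ℂ) :
    ampliation κ Φ (A - B) = ampliation κ Φ A - ampliation κ Φ B := by
  ext x y
  simp only [ampliation, of_apply, Matrix.sub_apply]
  rw [← Matrix.sub_apply, ← map_sub]
  rfl

lemma ampliation_smul (Φ : Matrix n n ℂ →ₗ[ℂ] Matrix n n ℂ) (c : ℂ)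
    (A : Matrix (κ × n) (κ × n) ℂ) : ampliation κ Φ (c • A) = c • ampliation κ Φ A := by
  ext x y
  simp only [ampliation, of_apply, Matrix.smul_apply]
  rw [← Matrix.smul_apply, ← map_smul]
  rfl

lemma ampliation_comp (Φ Ψ : Matrix n n ℂ →ₗ[ℂ] Matrix n n ℂ) (A : Matrix (κ × n) (κ × n) ℂ) :
    ampliation κ (Φ ∘ₗ Ψ) A = ampliation κ Φ (ampliation κ Ψ A) := rfl

lemma ampliation_id (A : Matrix (κ × n) (κ × n) ℂ) : ampliation κ LinearMap.id A = A := rfl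

lemma ampliation_kronecker (Φ : Matrix n n ℂ →ₗ[ℂ] Matrix n n ℂ) (E : Matrix κ κ ℂ)
    (X : Matrix n n ℂ) : ampliation κ Φ (E ⊗ₖ X) = E ⊗ₖ Φ X := by
  ext x y
  simp only [ampliation, of_apply, kroneckerMap_apply]
  rw [← smul_eq_mul, ← Matrix.smul_apply, ← map_smul]
  rfl

lemma trace_ampliation [Fintype n] [Fintype κ] {Φ : Matrix n n ℂ →ₗ[ℂ] Matrix n n ℂ}
    (h : ∀ X, (Φ X).trace = X.trace) (A : Matrix (κ × n) (κ × n) ℂ) :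
    (ampliation κ Φ A).trace = A.trace := by
  simp only [trace, diag_apply, Fintype.sum_prod_type]
  exact Finset.sum_congr rfl fun i _ => h (of fun a b => A (i, a) (i, b))

lemma ampliation_isHermitian {Φ : Matrix n n ℂ →ₗ[ℂ] Matrix n n ℂ}
    (h : ∀ X, Φ Xᴴ = (Φ X)ᴴ) {A : Matrix (κ × n) (κ × n) ℂ} (hA : A.IsHermitian) :
    (ampliation κ Φ A).IsHermitian := by
  ext x y
  simp only [ampliation, of_apply, conjTranspose_apply]
  rw [← conjTranspose_apply, ← h]
  refine congrArg (fun Z => Φ Z x.2 y.2) ?_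
  ext a b
  simp only [of_apply, conjTranspose_apply]
  exact hA.apply _ _

end Ampliation

/-! ### Choi matrices and complete positivity. -/

section Choi

variable {n : Type*} [Fintype n] [DecidableEq n]

/-- The Choi matrix `∑ i j, E i j ⊗ Φ (E i j)`. -/
def choi (Φ : Matrix n n ℂ →ₗ[ℂ] Matrix n n ℂ) : Matrix (n × n) (n × n) ℂ :=
  of fun x y => Φ (single x.1 y.1 1) x.2 y.2

/-- The linear map with a given Choi matrix. -/
def ofChoi (C : Matrix (n × n) (n × n) ℂ) : Matrix n n ℂ →ₗ[ℂ] Matrix n n ℂ where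
  toFun X := of fun a b => ∑ i, ∑ j, X i j * C (i, a) (j, b)
  map_add' X Y := by ext; simp [add_mul, Finset.sum_add_distrib]
  map_smul' c X := by ext; simp [mul_assoc, Finset.mul_sum]

omit [DecidableEq n] in
lemma ofChoi_apply (C : Matrix (n × n) (n × n) ℂ) (X : Matrix n n ℂ) (a b : n) :
    ofChoi C X a b = ∑ i, ∑ j, X i j * C (i, a) (j, b) := rfl

lemma ofChoi_choi (Φ : Matrix n n ℂ →ₗ[ℂ] Matrix n n ℂ) : ofChoi (choi Φ) = Φ := by
  ext1 X
  conv_rhs => rw [matrix_eq_sum_single X]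
  ext a b
  simp only [ofChoi_apply, choi, of_apply, map_sum, Matrix.sum_apply]
  refine Finset.sum_congr rfl fun i _ => Finset.sum_congr rfl fun j _ => ?_
  rw [← smul_eq_mul, ← Matrix.smul_apply, ← map_smul, smul_single, smul_eq_mul, mul_one]

omit [Fintype n] in
lemma choi_eq_ampliation (Φ : Matrix n n ℂ →ₗ[ℂ] Matrix n n ℂ) :
    choi Φ = ampliation n Φ (choi LinearMap.id) := by
  ext x y
  simp only [choi, ampliation, of_apply]
  rfl

omit [Fintype n] in
lemma choi_id_posSemidef [Finite n] :
    (choi (LinearMap.id : Matrix n n ℂ →ₗ[ℂ] Matrix n n ℂ)).PosSemidef := by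
  have : choi (LinearMap.id : Matrix n n ℂ →ₗ[ℂ] Matrix n n ℂ) =
      vecMulVec (fun x : n × n => if x.1 = x.2 then (1 : ℂ) else 0)
        (star fun x : n × n => if x.1 = x.2 then (1 : ℂ) else 0) := by
    ext x y
    by_cases h1 : x.1 = x.2 <;> by_cases h2 : y.1 = y.2 <;>
      simp [choi, vecMulVec_apply, single_apply, h1, h2]
  rw [this]
  exact posSemidef_vecMulVec_self_star _

/-- **Choi's theorem**: a map with positive semidefinite Choi matrix is completely positive. -/
theorem isCompletelyPositive_ofChoi {C : Matrix (n × n) (n × n) ℂ} (hC : C.PosSemidef) :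
    IsCompletelyPositive (ofChoi C) := by
  intro k A hA
  -- T identifies the inner index of A with the input index of C, so compressing A ⊗ C by T performs
  -- the contraction that defines the ampliation.
  let T : Matrix ((Fin k × n) × (n × n)) (Fin k × n) ℂ :=
    of fun x y => if x.1.1 = y.1 ∧ x.1.2 = x.2.1 ∧ x.2.2 = y.2 then 1 else 0
  have : ampliation (Fin k) (ofChoi C) A = Tᴴ * (A ⊗ₖ C) * T := by
    ext ⟨p, a⟩ ⟨q, b⟩
    simp only [ampliation, of_apply, ofChoi_apply, Matrix.mul_apply, Fintype.sum_prod_type,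
      conjTranspose_apply, T, kroneckerMap_apply, ite_and]
    simp [Finset.sum_ite_eq, apply_ite (star : ℂ → ℂ)]
    rw [Finset.sum_comm]
  rw [this]
  exact (hA.kronecker hC).conjTranspose_mul_mul_same T

theorem isCompletelyPositive_of_choi {Φ : Matrix n n ℂ →ₗ[ℂ] Matrix n n ℂ}
    (h : (choi Φ).PosSemidef) : IsCompletelyPositive Φ :=
  ofChoi_choi Φ ▸ isCompletelyPositive_ofChoi h

end Choi

namespace IsCompletelyPositive

variable {n : Type*}

lemma comp {Φ Ψ : Matrix n n ℂ →ₗ[ℂ] Matrix n n ℂ} (hΦ : IsCompletelyPositive Φ)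
    (hΨ : IsCompletelyPositive Ψ) : IsCompletelyPositive (Φ ∘ₗ Ψ) :=
  fun k _ hA => hΦ k _ (hΨ k _ hA)

lemma map_posSemidef {Φ : Matrix n n ℂ →ₗ[ℂ] Matrix n n ℂ} (hΦ : IsCompletelyPositive Φ)
    {A : Matrix n n ℂ} (hA : A.PosSemidef) : (Φ A).PosSemidef := by
  have h := (hΦ 1 (A.submatrix Prod.snd Prod.snd) (hA.submatrix Prod.snd)).submatrix
    (fun a : n => ((0 : Fin 1), a))
  exact h

variable [Fintype n] [DecidableEq n]

lemma map_isHermitian {Φ : Matrix n n ℂ →ₗ[ℂ] Matrix n n ℂ} (hΦ : IsCompletelyPositive Φ)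
    {A : Matrix n n ℂ} (hA : A.IsHermitian) : (Φ A).IsHermitian := by
  obtain ⟨P, Q, hP, hQ, rfl, -⟩ := exists_jordan hA
  rw [map_sub]
  exact (hΦ.map_posSemidef hP).isHermitian.sub (hΦ.map_posSemidef hQ).isHermitian

lemma map_conjTranspose {Φ : Matrix n n ℂ →ₗ[ℂ] Matrix n n ℂ} (hΦ : IsCompletelyPositive Φ)
    (X : Matrix n n ℂ) : Φ Xᴴ = (Φ X)ᴴ := by
  have h1 : (X + Xᴴ).IsHermitian := by simp [IsHermitian, add_comm]
  have h2 : (Complex.I • (X - Xᴴ)).IsHermitian := by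
    simp [IsHermitian, conjTranspose_smul, ← smul_neg]
  have e1 := (hΦ.map_isHermitian h1).eq
  have e2 := (hΦ.map_isHermitian h2).eq
  simp only [map_add, map_smul, map_sub, conjTranspose_add, conjTranspose_smul,
    conjTranspose_sub] at e1 e2
  ext i j
  have f1 := congrFun (congrFun e1 i) j
  have f2 := congrFun (congrFun e2 i) j
  simp only [Matrix.add_apply, Matrix.smul_apply, Matrix.sub_apply, conjTranspose_apply, smul_eq_mul, Complex.star_def,
    Complex.conj_I, neg_mul] at f1 f2 ⊢
  have f3 : Complex.I * ((starRingEnd ℂ) (Φ X j i) - (starRingEnd ℂ) (Φ Xᴴ j i) +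
    (Φ X i j - Φ Xᴴ i j)) = 0 := by linear_combination -f2
  have f4 := (mul_eq_zero.1 f3).resolve_left Complex.I_ne_zero
  linear_combination (-1/2) * f4 - (1/2) * f1

end IsCompletelyPositive

/-! ### Channels and trace norm contraction. -/

section Contractive

variable {n : Type*} [Fintype n] [DecidableEq n]

/-- Tensoring with the identity, a channel does not increase the trace norm. -/
theorem IsCPTP.traceNorm_ampliation_le {Φ : Matrix n n ℂ →ₗ[ℂ] Matrix n n ℂ} (hΦ : IsCPTP Φ)
    {k : ℕ} {A : Matrix (Fin k × n) (Fin k × n) ℂ} (hA : A.IsHermitian) :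
    traceNorm (ampliation (Fin k) Φ A) ≤ traceNorm A := by
  obtain ⟨P, Q, hP, hQ, rfl, h⟩ := exists_jordan hA
  rw [h, ampliation_sub]
  refine (traceNorm_sub_le (hΦ.1 k _ hP) (hΦ.1 k _ hQ)).trans_eq ?_
  rw [trace_ampliation hΦ.2, trace_ampliation hΦ.2]

/-- A trace preserving map on `M₂` whose ampliation contracts the trace norm is a channel. -/
theorem isCPTP_of_traceNorm_le {Φ : M2 →ₗ[ℂ] M2} (htr : ∀ X, (Φ X).trace = X.trace)
    (hH : ∀ X, Φ Xᴴ = (Φ X)ᴴ)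
    (h : traceNorm (choi Φ) ≤ traceNorm (choi (LinearMap.id : M2 →ₗ[ℂ] M2))) : IsCPTP Φ := by
  refine ⟨isCompletelyPositive_of_choi ?_, htr⟩
  have hc : (choi Φ).IsHermitian := by
    rw [choi_eq_ampliation]
    exact ampliation_isHermitian hH choi_id_posSemidef.isHermitian
  refine posSemidef_of_traceNorm_le hc ?_
  rw [choi_eq_ampliation, trace_ampliation htr, ← choi_eq_ampliation,
    ← traceNorm_of_posSemidef choi_id_posSemidef]
  exact h

lemma IsCPTP.choi_posSemidef {Φ : M2 →ₗ[ℂ] M2} (hΦ : IsCPTP Φ) : (choi Φ).PosSemidef := by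
  rw [choi_eq_ampliation]
  exact hΦ.1 2 _ choi_id_posSemidef

/-- Tensoring with a rank-one ancilla projection lets two-qubit contractivity specialise to the bare
qubit map. -/
lemma traceNorm_single_kronecker {k : Type*} [Fintype k] [DecidableEq k] (i : k)
    {X : Matrix n n ℂ} : traceNorm (single i i (1 : ℂ) ⊗ₖ X) = traceNorm X := by
  unfold traceNorm
  have h : CFC.sqrt ((single i i (1 : ℂ) ⊗ₖ X) * (single i i (1 : ℂ) ⊗ₖ X)ᴴ) =
      single i i (1 : ℂ) ⊗ₖ CFC.sqrt (X * Xᴴ) := by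
    have hX : (X * Xᴴ).PosSemidef := posSemidef_self_mul_conjTranspose X
    have hi : (single i i (1 : ℂ)).PosSemidef := by
      have := posSemidef_vecMulVec_self_star (Pi.single i (1 : ℂ))
      rwa [← Pi.single_star, star_one, ← single_eq_single_vecMulVec_single] at this
    have hS : (CFC.sqrt (X * Xᴴ)).PosSemidef :=
      nonneg_iff_posSemidef.1 (CFC.sqrt_nonneg (X * Xᴴ))
    refine CFC.sqrt_unique ?_ ?_
    · rw [conjTranspose_kronecker, ← mul_kronecker_mul, ← mul_kronecker_mul,
        CFC.sqrt_mul_sqrt_self _ hX.nonneg]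
      simp
    · exact (hi.kronecker hS).nonneg
  rw [h, trace_kronecker]
  simp

end Contractive
end QubitEvolution

namespace QubitEvolution
open Matrix
open scoped Kronecker

/-! ### Identities for 2 × 2 matrices. -/

section TwoByTwo

/-- For invertible A this is Cayley–Hamilton for A * B with a left factor A cancelled; the entrywise
check needs no invertibility. -/
lemma conj_mul_adjugate_identity (A B : M2) :
    B * A * B + B.det • A.adjugate = (A * B).trace • B := by
  ext i j
  fin_cases i <;> fin_cases j <;>
    simp [Matrix.mul_apply, Fin.sum_univ_two, det_fin_two, adjugate_fin_two, trace_fin_two] <;> ring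

lemma det_smul_add_smul (A B : M2) (p q : ℂ) :
    (p • A + q • B).det =
      p ^ 2 * A.det + q ^ 2 * B.det + p * q * (A.trace * B.trace - (A * B).trace) := by
  simp [Matrix.mul_apply, Fin.sum_univ_two, det_fin_two, trace_fin_two]
  ring

lemma isHermitian_det_eq {A : M2} (hA : A.IsHermitian) : A.det = (A.det.re : ℂ) := by
  have h : star A.det = A.det := by rw [← det_conjTranspose, hA.eq]
  exact (Complex.conj_eq_iff_re.1 h).symm

/-- For a traceless Hermitian matrix, -det is the squared length of its Bloch vector. -/
lemma isHermitian_det_nonpos_of_trace_eq_zero {A : M2} (hA : A.IsHermitian) (h : A.trace = 0) :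
    A.det.re ≤ 0 ∧ (A.det.re = 0 → A = 0) := by
  have h00 := hA.apply 0 0
  have h10 := hA.apply 1 0
  have h11 : A 1 1 = - A 0 0 := by rw [trace_fin_two] at h; linear_combination h
  have hr : (A 0 0).im = 0 := Complex.conj_eq_iff_im.1 h00
  have hd : A.det.re = - ((A 0 0).re ^ 2 + (A 0 1).re ^ 2 + (A 0 1).im ^ 2) := by
    rw [det_fin_two, h11, ← h10]
    simp [hr]
    ring
  have n0 := sq_nonneg (A 0 0).re
  have n1 := sq_nonneg (A 0 1).re
  have n2 := sq_nonneg (A 0 1).im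
  refine ⟨by linarith, fun h0 => ?_⟩
  have a0 : (A 0 0).re = 0 := by nlinarith
  have b0 : (A 0 1).re = 0 := by nlinarith
  have c0 : (A 0 1).im = 0 := by nlinarith
  have a : A 0 0 = 0 := Complex.ext a0 hr
  have b : A 0 1 = 0 := Complex.ext b0 c0
  ext i j
  fin_cases i <;> fin_cases j
  · exact a
  · exact b
  · simp only [Fin.mk_one, Fin.zero_eta]; rw [← h10, b]; simp
  · simp only [Fin.mk_one]; rw [h11, a]; simp

/-- A Hermitian `2 × 2` matrix with unit trace and zero determinant is a pure state. -/
lemma exists_pure {ρ : M2} (hρ : ρ.IsHermitian) (ht : ρ.trace = 1) (hd : ρ.det = 0) :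
    ∃ ψ : Fin 2 → ℂ, ρ = vecMulVec ψ (star ψ) := by
  have h00 := hρ.apply 0 0
  have h10 := hρ.apply 1 0
  have h11 : ρ 1 1 = 1 - ρ 0 0 := by rw [trace_fin_two] at ht; linear_combination ht
  have hr : ρ 0 0 = ((ρ 0 0).re : ℂ) := (Complex.conj_eq_iff_re.1 h00).symm
  set a := (ρ 0 0).re with ha
  have hd' : ρ 0 1 * star (ρ 0 1) = a * (1 - a) := by
    rw [det_fin_two, h11, hr] at hd
    rw [h10]
    linear_combination -hd
  have hn : Complex.normSq (ρ 0 1) = a * (1 - a) := by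
    have := hd'
    rw [Complex.star_def, Complex.mul_conj] at this
    exact_mod_cast this
  have hn0 := Complex.normSq_nonneg (ρ 0 1)
  by_cases h0 : a = 0
  · have hb : ρ 0 1 = 0 := Complex.normSq_eq_zero.1 (by rw [hn, h0]; simp)
    refine ⟨![0, 1], ?_⟩
    ext i j
    fin_cases i <;> fin_cases j <;> simp [vecMulVec_apply]
    · rw [hr, h0]; simp
    · exact hb
    · rw [← h10, hb]; simp
    · rw [h11, hr, h0]; simp
  · have hpos : 0 < a := by
      rcases lt_or_gt_of_ne h0 with h | h
      · nlinarith
      · exact h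
    have hs : (Real.sqrt a : ℂ) * Real.sqrt a = a := by
      exact_mod_cast Real.mul_self_sqrt hpos.le
    have hs0 : (Real.sqrt a : ℂ) ≠ 0 := by
      exact_mod_cast (Real.sqrt_pos.2 hpos).ne'
    refine ⟨![Real.sqrt a, star (ρ 0 1) / Real.sqrt a], ?_⟩
    ext i j
    fin_cases i <;> fin_cases j <;> simp [vecMulVec_apply]
    · rw [hr, hs]
    · field_simp
    · rw [← h10]; field_simp; simp
    · rw [h11, hr]
      have : (starRingEnd ℂ) (ρ 0 1) / √a * (ρ 0 1 / √a) =
        (ρ 0 1 * star (ρ 0 1)) / (√a * √a : ℂ) := by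
        rw [Complex.star_def]; field_simp
      rw [this, hd', hs]
      have : (a : ℂ) ≠ 0 := by exact_mod_cast h0
      field_simp

/-- Testing the form at p = √y, q = √x gives √(xy) (m + 2√(xy)) ≥ 0. When x or y vanishes, a large
multiple of the other variable is tested instead. -/
lemma nonneg_add_two_sqrt {m x y : ℝ} (hx : 0 ≤ x) (hy : 0 ≤ y)
    (h : ∀ p q : ℝ, 0 ≤ p → 0 ≤ q → 0 ≤ p * q * m + p ^ 2 * x + q ^ 2 * y) :
    0 ≤ m + 2 * Real.sqrt (x * y) := by
  by_contra! hm
  have hs := Real.sqrt_nonneg (x * y)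
  have hm0 : m < 0 := by linarith
  rcases hx.eq_or_lt with rfl | hx
  · have h1 := h ((y + 1) / (-m)) 1 (by apply div_nonneg <;> linarith) zero_le_one
    have h2 : (y + 1) / (-m) * 1 * m = - (y + 1) := by
      have := hm0.ne; field_simp
    rw [h2] at h1; linarith
  rcases hy.eq_or_lt with rfl | hy
  · have h1 := h 1 ((x + 1) / (-m)) zero_le_one (by apply div_nonneg <;> linarith)
    have h2 : 1 * ((x + 1) / (-m)) * m = - (x + 1) := by
      have := hm0.ne; field_simp
    rw [h2] at h1; linarith
  have h1 := h _ _ (Real.sqrt_nonneg y) (Real.sqrt_nonneg x)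
  rw [Real.sq_sqrt hx.le, Real.sq_sqrt hy.le, mul_comm (√y), ← Real.sqrt_mul hx.le] at h1
  have h3 : 0 < √(x * y) := Real.sqrt_pos.2 (mul_pos hx hy)
  have h4 := Real.mul_self_sqrt (mul_pos hx hy).le
  nlinarith

end TwoByTwo

/-! ### Positive block matrices with prescribed diagonal blocks and off-diagonal trace. -/

section Blocks

/-- A square root of `σ₁σ₂` realises the fidelity of two qubit states. -/
lemma exists_transition {A B : M2} (hA : A.PosSemidef) (hB : B.PosSemidef)
    (hdet : A.det.re ≠ 0 ∨ B.det.re = 0) {f : ℝ} (hf : f ≠ 0)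
    (hff : f ^ 2 = (A * B).trace.re + 2 * Real.sqrt (A.det.re * B.det.re)) :
    ∃ G : M2, Gᴴ * A * G = B ∧ (A * G).trace = f := by
  have hdA := isHermitian_det_eq hA.isHermitian
  have hdB := isHermitian_det_eq hB.isHermitian
  have hxA : 0 ≤ A.det.re := (Complex.le_def.1 hA.det_nonneg).1
  have hxB : 0 ≤ B.det.re := (Complex.le_def.1 hB.det_nonneg).1
  have htr : (A * B).trace = ((A * B).trace.re : ℂ) := by
    have h : star (A * B).trace = (A * B).trace := by
      rw [← trace_conjTranspose, conjTranspose_mul, hA.isHermitian.eq, hB.isHermitian.eq,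
        trace_mul_comm]
    exact (Complex.conj_eq_iff_re.1 h).symm
  set x := A.det.re
  set y := B.det.re
  set s := (A * B).trace.re
  set d := Real.sqrt (x * y)
  -- k = √(det B / det A), or 0 when both determinants vanish; `hdet` excludes the case with no
  -- solution. For invertible A, G = (B + k adj A)/f is the Hermitian solution of G A G = B.
  obtain ⟨k, hk1, hk2⟩ : ∃ k : ℝ, k * x = d ∧ k ^ 2 * x = y := by
    by_cases hx : x = 0
    · have hy : y = 0 := hdet.resolve_left (not_not.2 hx)
      exact ⟨0, by simp [d, hx], by simp [hy]⟩
    · have hx' : 0 < x := lt_of_le_of_ne hxA (Ne.symm hx)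
      have hd2 : d ^ 2 = x * y := Real.sq_sqrt (mul_nonneg hxA hxB)
      refine ⟨d / x, by field_simp, ?_⟩
      rw [div_pow, hd2]; field_simp
  have hk1' : (k : ℂ) * x = d := by exact_mod_cast hk1
  have hk2' : (k : ℂ) ^ 2 * x = y := by exact_mod_cast hk2
  have hff' : (f : ℂ) ^ 2 = s + 2 * d := by exact_mod_cast hff
  have hf' : (f : ℂ) ≠ 0 := by exact_mod_cast hf
  have hadj : A.adjugateᴴ = A.adjugate := by
    rw [adjugate_conjTranspose, hA.isHermitian.eq]
  have hG : ((f : ℂ)⁻¹ • (B + (k : ℂ) • A.adjugate))ᴴ = (f : ℂ)⁻¹ • (B + (k : ℂ) • A.adjugate) := by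
    simp [conjTranspose_smul, hadj, hB.isHermitian.eq]
  refine ⟨(f : ℂ)⁻¹ • (B + (k : ℂ) • A.adjugate), ?_, ?_⟩
  · rw [hG]
    have hid := conj_mul_adjugate_identity A B
    have e1 : (B + (k : ℂ) • A.adjugate) * A * (B + (k : ℂ) • A.adjugate) =
        (f ^ 2 : ℂ) • B := by
      have : (B + (k : ℂ) • A.adjugate) * A = B * A + ((k : ℂ) * A.det) • (1 : M2) := by
        rw [add_mul, Matrix.smul_mul, adjugate_mul, smul_smul]
      rw [this, add_mul, mul_add, Matrix.mul_smul, mul_assoc B A A.adjugate, mul_adjugate, Matrix.smul_mul,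
        one_mul, hff', hdA, hk1', Matrix.mul_smul, mul_one, smul_add, smul_smul, smul_smul]
      have e2 : (d : ℂ) * k = y := by rw [← hk1', ← hk2']; ring
      rw [hdB, htr] at hid
      rw [hk1', e2, add_smul, ← hid]
      module
    rw [Matrix.smul_mul, Matrix.smul_mul, Matrix.mul_smul, e1, smul_smul, smul_smul]
    have : (f : ℂ)⁻¹ * (f : ℂ)⁻¹ * f ^ 2 = 1 := by field_simp
    rw [this, one_smul]
  · rw [Matrix.mul_smul, mul_add, Matrix.mul_smul, mul_adjugate, trace_smul, trace_add, smul_smul, trace_smul,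
      htr, hdA, hk1', trace_one, smul_eq_mul, smul_eq_mul, Fintype.card_fin, inv_mul_eq_iff_eq_mul₀ hf', ← sq, hff']
    push_cast; ring

/-- Compressing A by the row (1, zG) gives diagonal blocks A, |z|²B and off-diagonal block zAG;
adding (1 - |z|²)B in the second corner restores B. -/
lemma exists_block_of_transition {A B G : M2} (hA : A.PosSemidef) (hB : B.PosSemidef)
    (hG : Gᴴ * A * G = B) {z : ℂ} (hz : Complex.normSq z ≤ 1) :
    ∃ C : Matrix (Fin 2 × Fin 2) (Fin 2 × Fin 2) ℂ, C.PosSemidef ∧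
      (∀ a b, C (0, a) (0, b) = A a b) ∧ (∀ a b, C (1, a) (1, b) = B a b) ∧
      ∑ a, C (0, a) (1, a) = z * (A * G).trace := by
  let T : Matrix (Fin 2) (Fin 2 × Fin 2) ℂ :=
    of fun a x => if x.1 = 0 then (1 : M2) a x.2 else (z • G) a x.2
  have hS : ((1 - Complex.normSq z : ℂ) • B).PosSemidef := by
    refine hB.smul ?_
    rw [sub_nonneg]
    exact_mod_cast hz
  have h11 : (single (1 : Fin 2) (1 : Fin 2) (1 : ℂ)).PosSemidef := by
    have := posSemidef_vecMulVec_self_star (Pi.single (1 : Fin 2) (1 : ℂ))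
    rwa [← Pi.single_star, star_one, ← single_eq_single_vecMulVec_single] at this
  have hT : ∀ i j a b, (Tᴴ * A * T) (i, a) (j, b) =
      ((if i = 0 then (1 : M2) else z • G)ᴴ * A * (if j = 0 then (1 : M2) else z • G)) a b := by
    intro i j a b
    simp only [Matrix.mul_apply, conjTranspose_apply, T, of_apply]
    refine Finset.sum_congr rfl fun x _ => ?_
    congr 1
    · refine Finset.sum_congr rfl fun y _ => ?_
      split_ifs <;> rfl
    · split_ifs <;> rfl
  refine ⟨Tᴴ * A * T + single 1 1 (1 : ℂ) ⊗ₖ ((1 - Complex.normSq z : ℂ) • B),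
    (hA.conjTranspose_mul_mul_same T).add (h11.kronecker hS), fun a b => ?_, fun a b => ?_, ?_⟩
  · rw [Matrix.add_apply, hT]; simp [kroneckerMap_apply]
  · rw [Matrix.add_apply, hT]
    simp only [one_ne_zero, if_false, conjTranspose_smul, Matrix.smul_mul, Matrix.mul_smul, hG,
      kroneckerMap_apply, single_apply_same, Matrix.smul_apply, smul_eq_mul, one_mul]
    rw [Complex.normSq_eq_conj_mul_self, Complex.star_def]
    ring
  · simp only [Matrix.add_apply, hT, kroneckerMap_apply]
    simp [trace, mul_add]

lemma exists_block_of_det {A B : M2} (hA : A.PosSemidef) (hB : B.PosSemidef)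
    (hdet : A.det.re ≠ 0 ∨ B.det.re = 0) {c : ℂ}
    (hc : Complex.normSq c ≤ (A * B).trace.re + 2 * Real.sqrt (A.det.re * B.det.re)) :
    ∃ C : Matrix (Fin 2 × Fin 2) (Fin 2 × Fin 2) ℂ, C.PosSemidef ∧
      (∀ a b, C (0, a) (0, b) = A a b) ∧ (∀ a b, C (1, a) (1, b) = B a b) ∧
      ∑ a, C (0, a) (1, a) = c := by
  set w := (A * B).trace.re + 2 * Real.sqrt (A.det.re * B.det.re) with hw
  have hc0 := Complex.normSq_nonneg c
  by_cases h0 : c = 0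
  · have h (i : Fin 2) : (single i i (1 : ℂ)).PosSemidef := by
      have := posSemidef_vecMulVec_self_star (Pi.single i (1 : ℂ))
      rwa [← Pi.single_star, star_one, ← single_eq_single_vecMulVec_single] at this
    refine ⟨single 0 0 (1 : ℂ) ⊗ₖ A + single 1 1 (1 : ℂ) ⊗ₖ B,
      ((h 0).kronecker hA).add ((h 1).kronecker hB), ?_, ?_, ?_⟩ <;>
      simp [kroneckerMap_apply, h0]
  · have hcp : 0 < Complex.normSq c := Complex.normSq_pos.2 h0
    have hwp : 0 < w := hcp.trans_le hc
    have hf : Real.sqrt w ≠ 0 := (Real.sqrt_pos.2 hwp).ne'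
    obtain ⟨G, hG, ht⟩ := exists_transition hA hB hdet hf (Real.sq_sqrt hwp.le)
    -- The off-diagonal trace is z√w, hence z = c/√w, and the bound on c is exactly |z| ≤ 1.
    obtain ⟨C, h1, h2, h3, h4⟩ := exists_block_of_transition hA hB hG (z := c / Real.sqrt w) (by
      rw [Complex.normSq_div, Complex.normSq_ofReal, Real.mul_self_sqrt hwp.le]
      exact div_le_one_of_le₀ hc hwp.le)
    refine ⟨C, h1, h2, h3, ?_⟩
    rw [h4, ht]
    have : (Real.sqrt w : ℂ) ≠ 0 := by exact_mod_cast hf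
    field_simp

/-- The bound on c is symmetric in A and B, so the case det A = 0 ≠ det B left out by
`exists_block_of_det` follows by swapping the two blocks. -/
lemma exists_block {A B : M2} (hA : A.PosSemidef) (hB : B.PosSemidef) {c : ℂ}
    (hc : Complex.normSq c ≤ (A * B).trace.re + 2 * Real.sqrt (A.det.re * B.det.re)) :
    ∃ C : Matrix (Fin 2 × Fin 2) (Fin 2 × Fin 2) ℂ, C.PosSemidef ∧
      (∀ a b, C (0, a) (0, b) = A a b) ∧ (∀ a b, C (1, a) (1, b) = B a b) ∧
      ∑ a, C (0, a) (1, a) = c := by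
  by_cases hdet : A.det.re ≠ 0 ∨ B.det.re = 0
  · exact exists_block_of_det hA hB hdet hc
  · push Not at hdet
    obtain ⟨C, h1, h2, h3, h4⟩ := exists_block_of_det (c := star c) hB hA (Or.inl hdet.2) (by
      rw [trace_mul_comm, mul_comm B.det.re, Complex.star_def, Complex.normSq_conj]; exact hc)
    refine ⟨C.submatrix (Prod.map (Equiv.swap 0 1) id) (Prod.map (Equiv.swap 0 1) id),
      h1.submatrix _, by simpa using h3, by simpa using h2, ?_⟩
    have := congrArg star h4
    rw [star_star, star_sum] at this
    rw [← this]
    refine Finset.sum_congr rfl fun a _ => ?_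
    simpa using (h1.isHermitian.apply (1, a) (0, a)).symm

end Blocks
end QubitEvolution

namespace QubitEvolution
open Matrix
open scoped Kronecker

/-! ### Channels with prescribed values on two pure states. -/

section Channels

/-- Conjugation `X ↦ B X B†`. -/
def conjMap {n : Type*} [Fintype n] (B : Matrix n n ℂ) : Matrix n n ℂ →ₗ[ℂ] Matrix n n ℂ where
  toFun X := B * X * Bᴴ
  map_add' X Y := by rw [mul_add, add_mul]
  map_smul' c X := by rw [Matrix.mul_smul, Matrix.smul_mul, RingHom.id_apply]

lemma conjMap_apply {n : Type*} [Fintype n] (B X : Matrix n n ℂ) : conjMap B X = B * X * Bᴴ := rfl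

lemma isCompletelyPositive_conjMap {n : Type*} [Fintype n] [DecidableEq n] (B : Matrix n n ℂ) :
    IsCompletelyPositive (conjMap B) := by
  apply isCompletelyPositive_of_choi
  have : choi (conjMap B) = vecMulVec (fun x => B x.2 x.1) (star fun x => B x.2 x.1) := by
    ext x y
    simp [choi, conjMap_apply, vecMulVec_apply, Matrix.mul_apply, single_apply, ite_and]
  rw [this]
  exact posSemidef_vecMulVec_self_star _

/-- Conjugation by W⁻¹ sends the two pure inputs to the basis projections, and the diagonal blocks
of C send these to A and B. Trace preservation on the off-diagonal units demands that the
off-diagonal block of C have trace equal to the overlap of the columns of W; `hc` makes such a C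
available. -/
lemma exists_channel_of_gram {W A B : M2} (hW : W.det ≠ 0) (h0 : (Wᴴ * W) 0 0 = 1)
    (h1 : (Wᴴ * W) 1 1 = 1) (hA : A.PosSemidef) (hB : B.PosSemidef) (hAt : A.trace = 1)
    (hBt : B.trace = 1) (hc : Complex.normSq ((Wᴴ * W) 1 0) ≤
      (A * B).trace.re + 2 * Real.sqrt (A.det.re * B.det.re)) :
    ∃ V : M2 →ₗ[ℂ] M2, IsCPTP V ∧ V (W * single 0 0 1 * Wᴴ) = A ∧
      V (W * single 1 1 1 * Wᴴ) = B := by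
  obtain ⟨C, hC, hCA, hCB, hCc⟩ := exists_block hA hB hc
  have hu : IsUnit W.det := isUnit_iff_ne_zero.2 hW
  have hu' : IsUnit Wᴴ.det := by rw [det_conjTranspose]; exact hu.star
  have hinv (X : M2) : W⁻¹ * (W * X * Wᴴ) * W⁻¹ᴴ = X := by
    rw [conjTranspose_nonsing_inv, mul_assoc W, nonsing_inv_mul_cancel_left _ _ hu,
      mul_nonsing_inv_cancel_right _ _ hu']
  have hinv' (X : M2) : W * (W⁻¹ * X * W⁻¹ᴴ) * Wᴴ = X := by
    rw [conjTranspose_nonsing_inv, mul_assoc W⁻¹, mul_nonsing_inv_cancel_left _ _ hu,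
      nonsing_inv_mul_cancel_right _ _ hu']
  refine ⟨ofChoi C ∘ₗ conjMap W⁻¹, ⟨(isCompletelyPositive_ofChoi hC).comp
    (isCompletelyPositive_conjMap _), fun X => ?_⟩, ?_, ?_⟩
  · rw [LinearMap.comp_apply, conjMap_apply]
    obtain ⟨Y, rfl⟩ : ∃ Y, X = W * Y * Wᴴ := ⟨_, (hinv' X).symm⟩
    rw [hinv, trace_mul_cycle, trace_mul_comm]
    have hcc : ∑ a, C (1, a) (0, a) = (Wᴴ * W) 0 1 := by
      have h2 : (Wᴴ * W).IsHermitian := isHermitian_conjTranspose_mul_self W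
      rw [← h2.apply 0 1, ← hCc, star_sum]
      exact Finset.sum_congr rfl fun a _ => (hC.isHermitian.apply _ _).symm
    rw [Fin.sum_univ_two] at hcc hCc
    rw [trace_fin_two] at hAt hBt
    simp only [trace_fin_two, ofChoi_apply, Fin.sum_univ_two, hCA, hCB]
    rw [Matrix.mul_apply, Matrix.mul_apply, Fin.sum_univ_two, Fin.sum_univ_two, h0, h1, ← hcc, ← hCc]
    linear_combination Y 0 0 * hAt + Y 1 1 * hBt
  · rw [LinearMap.comp_apply, conjMap_apply, hinv]
    ext a b
    simp [ofChoi_apply, hCA, single_apply]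
  · rw [LinearMap.comp_apply, conjMap_apply, hinv]
    ext a b
    simp [ofChoi_apply, hCB, single_apply]

/-- The Alberti–Uhlmann theorem for a pair of pure qubit states. -/
theorem exists_channel_of_pure {ρ₁ ρ₂ σ₁ σ₂ : M2} (hρ₁ : ρ₁.IsHermitian) (hρ₂ : ρ₂.IsHermitian)
    (hσ₁ : σ₁.IsHermitian) (hσ₂ : σ₂.IsHermitian) (tρ₁ : ρ₁.trace = 1) (tρ₂ : ρ₂.trace = 1)
    (tσ₁ : σ₁.trace = 1) (tσ₂ : σ₂.trace = 1) (dρ₁ : ρ₁.det = 0) (dρ₂ : ρ₂.det = 0)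
    (hne : ρ₁ ≠ ρ₂)
    (h : ∀ p q : ℝ, traceNorm ((p : ℂ) • σ₁ + (q : ℂ) • σ₂) ≤
      traceNorm ((p : ℂ) • ρ₁ + (q : ℂ) • ρ₂)) :
    ∃ V : M2 →ₗ[ℂ] M2, IsCPTP V ∧ V ρ₁ = σ₁ ∧ V ρ₂ = σ₂ := by
  obtain ⟨ψ, hψ⟩ := exists_pure hρ₁ tρ₁ dρ₁
  obtain ⟨φ, hφ⟩ := exists_pure hρ₂ tρ₂ dρ₂
  have pρ₁ : ρ₁.PosSemidef := hψ ▸ posSemidef_vecMulVec_self_star _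
  have pρ₂ : ρ₂.PosSemidef := hφ ▸ posSemidef_vecMulVec_self_star _
  have pσ₁ : σ₁.PosSemidef := by
    refine posSemidef_of_traceNorm_le hσ₁ ?_
    have := h 1 0
    simp only [Complex.ofReal_one, one_smul, Complex.ofReal_zero, zero_smul, add_zero] at this
    rwa [traceNorm_of_posSemidef pρ₁, tρ₁, ← tσ₁] at this
  have pσ₂ : σ₂.PosSemidef := by
    refine posSemidef_of_traceNorm_le hσ₂ ?_
    have := h 0 1
    simp only [Complex.ofReal_one, one_smul, Complex.ofReal_zero, zero_smul, zero_add] at this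
    rwa [traceNorm_of_posSemidef pρ₂, tρ₂, ← tσ₂] at this
  have hxσ₁ := (Complex.le_def.1 pσ₁.det_nonneg).1
  have hxσ₂ := (Complex.le_def.1 pσ₂.det_nonneg).1
  have herm {A B : M2} (hA : A.IsHermitian) (hB : B.IsHermitian) (p q : ℝ) :
      ((p : ℂ) • A + (q : ℂ) • B).IsHermitian := by
    simp [IsHermitian, conjTranspose_smul, hA.eq, hB.eq]
  have hdet {A B : M2} (hA : A.IsHermitian) (hB : B.IsHermitian) (tA : A.trace = 1)
      (tB : B.trace = 1) (p q : ℝ) : ((p : ℂ) • A + (q : ℂ) • B).det.re =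
        p ^ 2 * A.det.re + q ^ 2 * B.det.re + p * q * (1 - (A * B).trace.re) := by
    rw [det_smul_add_smul, tA, tB, isHermitian_det_eq hA, isHermitian_det_eq hB]
    simp [← Complex.ofReal_pow, ← Complex.ofReal_mul]
  have hgap : (ρ₁ * ρ₂).trace.re < 1 := by
    have h0 : ((ρ₁ - ρ₂)).IsHermitian := hρ₁.sub hρ₂
    obtain ⟨h2, h3⟩ := isHermitian_det_nonpos_of_trace_eq_zero h0 (by rw [trace_sub, tρ₁, tρ₂, sub_self])
    have h4 : (ρ₁ - ρ₂).det.re < 0 :=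
      lt_of_le_of_ne h2 fun h => hne (sub_eq_zero.1 (h3 h))
    have h5 := hdet hρ₁ hρ₂ tρ₁ tρ₂ 1 (-1)
    simp only [Complex.ofReal_one, one_smul, Complex.ofReal_neg, neg_smul, ← sub_eq_add_neg, dρ₁,
      dρ₂, Complex.zero_re] at h5
    linarith
  -- On pρ₁ - qρ₂ the determinant is -pq(1 - tr ρ₁ρ₂) ≤ 0, so the squared norm is tr² - 4 det; on
  -- the σ side it is at least tr² - 4 det. The traces agree, so contractivity becomes nonnegativity
  -- of a binary quadratic form.
  have hkey : 0 ≤ ((σ₁ * σ₂).trace.re - (ρ₁ * ρ₂).trace.re) +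
      2 * Real.sqrt (σ₁.det.re * σ₂.det.re) := by
    refine nonneg_add_two_sqrt hxσ₁ hxσ₂ fun p q hp hq => ?_
    have h1 := pow_le_pow_left₀ (traceNorm_nonneg _) (h p (-q)) 2
    rw [traceNorm_sq (herm hσ₁ hσ₂ _ _), traceNorm_sq (herm hρ₁ hρ₂ _ _), hdet hσ₁ hσ₂ tσ₁ tσ₂,
      hdet hρ₁ hρ₂ tρ₁ tρ₂, dρ₁, dρ₂] at h1
    have h2 : ((p : ℂ) • σ₁ + ((-q : ℝ) : ℂ) • σ₂).trace = ((p : ℂ) • ρ₁ + ((-q : ℝ) : ℂ) • ρ₂).trace := by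
      simp only [trace_add, trace_smul, tσ₁, tσ₂, tρ₁, tρ₂]
    rw [h2] at h1
    have h3 : 0 ≤ p * q * (1 - (ρ₁ * ρ₂).trace.re) :=
      mul_nonneg (mul_nonneg hp hq) (by linarith)
    have h4 : |p ^ 2 * (0 : ℂ).re + (-q) ^ 2 * (0 : ℂ).re + p * -q * (1 - (ρ₁ * ρ₂).trace.re)| =
        p * q * (1 - (ρ₁ * ρ₂).trace.re) := by
      rw [← abs_of_nonneg h3, ← abs_neg]; congr 1; simp
    rw [h4] at h1
    have h5 := neg_abs_le (p ^ 2 * σ₁.det.re + (-q) ^ 2 * σ₂.det.re + p * -q * (1 - (σ₁ * σ₂).trace.re))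
    have h6 := abs_nonneg (p ^ 2 * σ₁.det.re + (-q) ^ 2 * σ₂.det.re + p * -q * (1 - (σ₁ * σ₂).trace.re))
    simp only [Complex.zero_re, mul_zero, zero_add] at h1
    nlinarith
  -- The columns of W are the two pure state vectors; their overlap has squared modulus tr ρ₁ρ₂ < 1,
  -- so W is invertible.
  let W : M2 := of fun a i => if i = 0 then ψ a else φ a
  have hW0 : W * single 0 0 1 * Wᴴ = ρ₁ := by
    rw [hψ]; ext a b
    simp [W, Matrix.mul_apply, Fin.sum_univ_two, single_apply, vecMulVec_apply]
  have hW1 : W * single 1 1 1 * Wᴴ = ρ₂ := by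
    rw [hφ]; ext a b
    simp [W, Matrix.mul_apply, Fin.sum_univ_two, single_apply, vecMulVec_apply]
  have g0 : (Wᴴ * W) 0 0 = 1 := by
    rw [← tρ₁, hψ]
    simp [W, Matrix.mul_apply, Fin.sum_univ_two, mul_comm]
  have g1 : (Wᴴ * W) 1 1 = 1 := by
    rw [← tρ₂, hφ]
    simp [W, Matrix.mul_apply, Fin.sum_univ_two, mul_comm]
  have g2 : ((Wᴴ * W) 1 0) * (Wᴴ * W) 0 1 = (ρ₁ * ρ₂).trace := by
    rw [hψ, hφ]
    simp [W, Matrix.mul_apply, Fin.sum_univ_two, vecMulVec_apply, trace_fin_two]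
    ring
  have g3 : Complex.normSq ((Wᴴ * W) 1 0) = (ρ₁ * ρ₂).trace.re := by
    rw [← g2, ← (isHermitian_conjTranspose_mul_self W).apply 0 1, Complex.star_def,
      Complex.mul_conj, Complex.ofReal_re]
  have g4 : W.det ≠ 0 := by
    intro h0
    have h1 : (Wᴴ * W).det = 0 := by rw [det_mul, h0, mul_zero]
    rw [det_fin_two, g0, g1, mul_comm ((Wᴴ * W) 0 1), g2] at h1
    have := congrArg Complex.re h1
    simp at this
    linarith
  obtain ⟨V, hV, hV0, hV1⟩ := exists_channel_of_gram g4 g0 g1 pσ₁ pσ₂ tσ₁ tσ₂ (by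
    rw [g3]; linarith)
  exact ⟨V, hV, hW0 ▸ hV0, hW1 ▸ hV1⟩

end Channels
end QubitEvolution

namespace QubitEvolution
open Matrix
open scoped Kronecker

/-! ### Factorization through a map of rank at most two. -/

section Factorization

lemma eq_of_eqOn_density {Φ Ψ : M2 →ₗ[ℂ] M2} (h : ∀ ρ : M2, IsDensity ρ → Φ ρ = Ψ ρ) :
    Φ = Ψ := by
  have hp (A : M2) (hA : A.PosSemidef) : Φ A = Ψ A := by
    by_cases h0 : A.trace = 0
    · rw [hA.trace_eq_zero_iff.1 h0, map_zero, map_zero]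
    · have h1 := h ((A.trace)⁻¹ • A) ⟨hA.smul (inv_nonneg.2 hA.trace_nonneg), by
        rw [trace_smul, smul_eq_mul, inv_mul_cancel₀ h0]⟩
      rw [map_smul, map_smul] at h1
      exact smul_right_injective _ (inv_ne_zero h0) h1
  have hh (A : M2) (hA : A.IsHermitian) : Φ A = Ψ A := by
    obtain ⟨P, Q, hP, hQ, rfl, -⟩ := exists_jordan hA
    rw [map_sub, map_sub, hp P hP, hp Q hQ]
  ext1 X
  have h1 := hh (X + Xᴴ) (by simp [IsHermitian, add_comm])
  have h2 := hh (Complex.I • (X - Xᴴ)) (by simp [IsHermitian, conjTranspose_smul, ← smul_neg])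
  simp only [map_add, map_smul, map_sub] at h1 h2
  have h3 : Φ X - Φ Xᴴ = Ψ X - Ψ Xᴴ := smul_right_injective _ Complex.I_ne_zero h2
  have h4 : (2 : ℂ) • Φ X = (2 : ℂ) • Ψ X := by
    rw [two_smul, two_smul]
    have e : Φ X + Φ X = (Φ X + Φ Xᴴ) + (Φ X - Φ Xᴴ) := by abel
    rw [e, h1, h3]
    abel
  exact smul_right_injective _ two_ne_zero h4

/-- A Hermitian matrix killed by Φ has image of norm zero under Ψ; Hermitian and anti-Hermitian
parts extend this to all of the kernel. -/
lemma ker_le_of_traceNorm_le {Φ Ψ : M2 →ₗ[ℂ] M2} (hΦ : IsCPTP Φ) (hΨ : IsCPTP Ψ)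
    (h : ∀ X : M2, X.IsHermitian → traceNorm (Ψ X) ≤ traceNorm (Φ X)) :
    LinearMap.ker Φ ≤ LinearMap.ker Ψ := by
  have hh (A : M2) (hA : A.IsHermitian) (h0 : Φ A = 0) : Ψ A = 0 :=
    eq_zero_of_traceNorm_le_zero (hΨ.1.map_isHermitian hA) (by simpa [h0] using h A hA)
  intro X hX
  rw [LinearMap.mem_ker] at hX ⊢
  have hX' : Φ Xᴴ = 0 := by rw [hΦ.1.map_conjTranspose, hX, conjTranspose_zero]
  have h1 := hh (X + Xᴴ) (by simp [IsHermitian, add_comm]) (by rw [map_add, hX, hX', add_zero])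
  have h2 := hh (Complex.I • (X - Xᴴ)) (by simp [IsHermitian, conjTranspose_smul, ← smul_neg])
    (by rw [map_smul, map_sub, hX, hX', sub_zero, smul_zero])
  rw [map_smul, map_sub, smul_eq_zero] at h2
  have h3 := h2.resolve_left Complex.I_ne_zero
  rw [map_add, ← sub_eq_zero.1 h3, ← two_smul ℂ] at h1
  exact (smul_eq_zero.1 h1).resolve_left two_ne_zero

/-- The channel which replaces every state by `σ`. -/
lemma isCPTP_replace {σ : M2} (hσ : IsDensity σ) :
    ∃ V : M2 →ₗ[ℂ] M2, IsCPTP V ∧ ∀ X, V X = X.trace • σ := by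
  have hV (X : M2) : ofChoi ((1 : M2) ⊗ₖ σ) X = X.trace • σ := by
    ext a b
    simp [ofChoi_apply, kroneckerMap_apply, trace_fin_two]
    ring
  refine ⟨_, ⟨isCompletelyPositive_ofChoi (PosSemidef.one.kronecker hσ.1), fun X => ?_⟩, hV⟩
  rw [hV, trace_smul, hσ.2, smul_eq_mul, mul_one]

/-- A concave parabola that is nonnegative at 0 and at 1 has positive discriminant. -/
lemma exists_two_roots {k b a : ℝ} (hk : k < 0) (ha : 0 ≤ a) (h : 0 ≤ k + b + a) :
    ∃ x y : ℝ, x ≠ y ∧ k * x ^ 2 + b * x + a = 0 ∧ k * y ^ 2 + b * y + a = 0 := by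
  have hd : 0 < b ^ 2 - 4 * k * a := by
    rcases ha.eq_or_lt with rfl | ha
    · have : b ≠ 0 := by rintro rfl; linarith
      rw [mul_zero, sub_zero]; positivity
    · nlinarith [sq_nonneg b, mul_pos (neg_pos.2 hk) ha]
  have hs := Real.sqrt_pos.2 hd
  have hss := Real.sq_sqrt hd.le
  set r := Real.sqrt (b ^ 2 - 4 * k * a)
  have hk0 := hk.ne
  refine ⟨(-b + r) / (2 * k), (-b - r) / (2 * k), fun he => ?_, ?_, ?_⟩
  · field_simp at he
    linarith
  · field_simp
    linear_combination hss
  · field_simp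
    linear_combination hss

/-- If the image of `Φ` has dimension at most two, contractivity alone yields a channel `V` with
`Ψ = V ∘ Φ`. -/
theorem exists_channel_of_finrank_le_two {Φ Ψ : M2 →ₗ[ℂ] M2} (hΦ : IsCPTP Φ) (hΨ : IsCPTP Ψ)
    (h : ∀ X : M2, X.IsHermitian → traceNorm (Ψ X) ≤ traceNorm (Φ X))
    (hr : Module.finrank ℂ (LinearMap.range Φ) ≤ 2) :
    ∃ V : M2 →ₗ[ℂ] M2, IsCPTP V ∧ Ψ = V ∘ₗ Φ := by
  have hker := ker_le_of_traceNorm_le hΦ hΨ h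
  have hfac {X Y : M2} (hXY : Φ X = Φ Y) : Ψ X = Ψ Y := by
    have : X - Y ∈ LinearMap.ker Ψ := hker (by rw [LinearMap.mem_ker, map_sub, hXY, sub_self])
    rwa [LinearMap.mem_ker, map_sub, sub_eq_zero] at this
  by_cases hc : ∀ τ τ' : M2, IsDensity τ → IsDensity τ' → Φ τ = Φ τ'
  · have hτ : IsDensity (single 0 0 1 : M2) := by
      refine ⟨?_, by simp⟩
      have := posSemidef_vecMulVec_self_star (Pi.single (0 : Fin 2) (1 : ℂ))
      rwa [← Pi.single_star, star_one, ← single_eq_single_vecMulVec_single] at this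
    obtain ⟨V, hV, hVX⟩ := isCPTP_replace (σ := Ψ (single 0 0 1))
      ⟨hΨ.1.map_posSemidef hτ.1, by rw [hΨ.2, hτ.2]⟩
    refine ⟨V, hV, eq_of_eqOn_density fun ρ hρ => ?_⟩
    rw [LinearMap.comp_apply, hVX, hΦ.2, hρ.2, one_smul]
    exact hfac (hc _ _ hρ hτ)
  push Not at hc
  obtain ⟨τ, τ', hτ, hτ', hne⟩ := hc
  have hA := hΦ.1.map_posSemidef hτ.1
  have hB := hΦ.1.map_posSemidef hτ'.1
  have tA : (Φ τ).trace = 1 := by rw [hΦ.2, hτ.2]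
  have tB : (Φ τ').trace = 1 := by rw [hΦ.2, hτ'.2]
  have hdA := (Complex.le_def.1 hA.det_nonneg).1
  have hdB := (Complex.le_def.1 hB.det_nonneg).1
  rw [Complex.zero_re] at hdA hdB
  have hdet (p q : ℝ) : ((p : ℂ) • Φ τ + (q : ℂ) • Φ τ').det.re =
        p ^ 2 * (Φ τ).det.re + q ^ 2 * (Φ τ').det.re + p * q * (1 - (Φ τ * Φ τ').trace.re) := by
    rw [det_smul_add_smul, tA, tB, isHermitian_det_eq hA.isHermitian,
      isHermitian_det_eq hB.isHermitian]
    simp [← Complex.ofReal_pow, ← Complex.ofReal_mul]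
  have hk : (Φ τ).det.re + (Φ τ').det.re - (1 - (Φ τ * Φ τ').trace.re) < 0 := by
    obtain ⟨h2, h3⟩ := isHermitian_det_nonpos_of_trace_eq_zero
      (hA.isHermitian.sub hB.isHermitian) (by rw [trace_sub, tA, tB, sub_self])
    have h4 := lt_of_le_of_ne h2 fun h => hne (sub_eq_zero.1 (h3 h))
    have h5 := hdet 1 (-1)
    simp only [Complex.ofReal_one, one_smul, Complex.ofReal_neg, neg_smul,
      ← sub_eq_add_neg] at h5
    linarith
  -- The quadratic is the determinant along the line (1 - r)Φ τ + r Φ τ'. Its leading coefficient is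
  -- det(Φ τ - Φ τ') < 0, and its values at r = 0 and r = 1 are determinants of states.
  obtain ⟨x, y, hxy, hx, hy⟩ := exists_two_roots
    (b := (1 - (Φ τ * Φ τ').trace.re) - 2 * (Φ τ).det.re) hk hdA (by linarith)
  have hline (r : ℝ) : Φ (((1 - r : ℝ) : ℂ) • τ + (r : ℂ) • τ') =
      ((1 - r : ℝ) : ℂ) • Φ τ + (r : ℂ) • Φ τ' := by
    rw [map_add, map_smul, map_smul]
  have hherm (r : ℝ) : (((1 - r : ℝ) : ℂ) • τ + (r : ℂ) • τ').IsHermitian := by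
    rw [IsHermitian, conjTranspose_add, conjTranspose_smul, conjTranspose_smul,
      hτ.1.isHermitian.eq, hτ'.1.isHermitian.eq, Complex.star_def,
      Complex.conj_ofReal, Complex.conj_ofReal]
  have htr (r : ℝ) : (((1 - r : ℝ) : ℂ) • τ + (r : ℂ) • τ').trace = 1 := by
    rw [trace_add, trace_smul, trace_smul, hτ.2, hτ'.2]; push_cast; simp
  have hzero (r : ℝ) (hr : ((Φ τ).det.re + (Φ τ').det.re - (1 - (Φ τ * Φ τ').trace.re)) * r ^ 2 +
      ((1 - (Φ τ * Φ τ').trace.re) - 2 * (Φ τ).det.re) * r + (Φ τ).det.re = 0) :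
      (Φ (((1 - r : ℝ) : ℂ) • τ + (r : ℂ) • τ')).det = 0 := by
    rw [isHermitian_det_eq (hΦ.1.map_isHermitian (hherm r)), hline, hdet, ← Complex.ofReal_zero]
    congr 1
    linear_combination hr
  -- u and v need not be states, since the roots may lie outside [0, 1]; only Hermiticity and unit
  -- trace are used, so contractivity on all Hermitian matrices matters here.
  obtain ⟨u, hu⟩ : ∃ u, u = ((1 - x : ℝ) : ℂ) • τ + (x : ℂ) • τ' := ⟨_, rfl⟩
  obtain ⟨v, hv⟩ : ∃ v, v = ((1 - y : ℝ) : ℂ) • τ + (y : ℂ) • τ' := ⟨_, rfl⟩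
  have huv : Φ u ≠ Φ v := by
    intro he
    rw [hu, hv, hline, hline] at he
    have h1 : ((x - y : ℝ) : ℂ) • (Φ τ - Φ τ') = 0 := by
      rw [← sub_eq_zero] at he
      rw [← neg_eq_zero, ← he]
      push_cast
      module
    rcases smul_eq_zero.1 h1 with h2 | h2
    · exact hxy (sub_eq_zero.1 (by exact_mod_cast h2))
    · exact hne (sub_eq_zero.1 h2)
  have Hu : u.IsHermitian := hu ▸ hherm x
  have Hv : v.IsHermitian := hv ▸ hherm y
  have tu : u.trace = 1 := hu ▸ htr x
  have tv : v.trace = 1 := hv ▸ htr y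
  have du : (Φ u).det = 0 := hu ▸ hzero x hx
  have dv : (Φ v).det = 0 := hv ▸ hzero y hy
  obtain ⟨V, hV, hV1, hV2⟩ := exists_channel_of_pure (hΦ.1.map_isHermitian Hu)
    (hΦ.1.map_isHermitian Hv) (hΨ.1.map_isHermitian Hu) (hΨ.1.map_isHermitian Hv)
    (by rw [hΦ.2, tu]) (by rw [hΦ.2, tv]) (by rw [hΨ.2, tu]) (by rw [hΨ.2, tv]) du dv huv
    (fun p q => by
      simp only [← map_smul, ← map_add]
      refine h _ ?_
      rw [IsHermitian, conjTranspose_add, conjTranspose_smul, conjTranspose_smul,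
        Hu.eq, Hv.eq, Complex.star_def, Complex.conj_ofReal, Complex.conj_ofReal])
  refine ⟨V, hV, ?_⟩
  have hli : LinearIndependent ℂ ![Φ u, Φ v] := by
    rw [LinearIndependent.pair_iff]
    intro s t hst
    have h1 := congrArg trace hst
    rw [trace_add, trace_smul, trace_smul, hΦ.2, hΦ.2, tu, tv, trace_zero, smul_eq_mul, smul_eq_mul, mul_one,
      mul_one] at h1
    have h2 : t = -s := by linear_combination h1
    rw [h2, neg_smul, ← sub_eq_add_neg, ← smul_sub, smul_eq_zero] at hst
    have h3 := hst.resolve_right fun h => huv (sub_eq_zero.1 h)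
    exact ⟨h3, by rw [h2, h3, neg_zero]⟩
  have hspan : Submodule.span ℂ (Set.range ![Φ u, Φ v]) = LinearMap.range Φ := by
    refine Submodule.eq_of_le_of_finrank_le ?_ ?_
    · rw [Submodule.span_le]
      rintro _ ⟨i, rfl⟩
      fin_cases i
      · exact ⟨u, rfl⟩
      · exact ⟨v, rfl⟩
    · rw [finrank_span_eq_card hli]; simpa using hr
  ext1 X
  have hX : Φ X ∈ Submodule.span ℂ (Set.range ![Φ u, Φ v]) := hspan ▸ ⟨X, rfl⟩
  rw [Matrix.range_cons, Matrix.range_cons, Matrix.range_empty, Set.union_empty,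
    Set.singleton_union, Submodule.mem_span_pair] at hX
  obtain ⟨s, t, hst⟩ := hX
  rw [LinearMap.comp_apply, ← hst, map_add, map_smul, map_smul, hV1, hV2, ← map_smul, ← map_smul,
    ← map_add]
  exact hfac (by rw [← hst, map_add, map_smul, map_smul])

end Factorization
end QubitEvolution

namespace QubitEvolution
open Matrix Filter
open scoped Kronecker Topology

/-! ### Rank-three projections and limits of channels. -/

section Limits

/-- There is no completely positive trace preserving projection onto a three-dimensional subspace
of `M₂`. -/
theorem finrank_range_ne_three {P : M2 →ₗ[ℂ] M2} (hP : IsCPTP P)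
    (hfix : ∀ X, P (P X) = P X) : Module.finrank ℂ (LinearMap.range P) ≠ 3 := by
  intro hr
  have hk : Module.finrank ℂ (LinearMap.ker P) = 1 := by
    have := LinearMap.finrank_range_add_finrank_ker P
    rw [hr, Module.finrank_matrix] at this
    simp at this
    omega
  obtain ⟨K, hK, hK0, hKH⟩ : ∃ K : M2, P K = 0 ∧ K ≠ 0 ∧ K.IsHermitian := by
    obtain ⟨⟨K, hK⟩, hK0, -⟩ := finrank_eq_one_iff'.1 hk
    rw [LinearMap.mem_ker] at hK
    have hK0 : K ≠ 0 := fun h => hK0 (Subtype.ext h)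
    have hK' : P Kᴴ = 0 := by rw [hP.1.map_conjTranspose, hK, conjTranspose_zero]
    by_cases h : K + Kᴴ = 0
    · refine ⟨Complex.I • (K - Kᴴ), by rw [map_smul, map_sub, hK, hK', sub_zero, smul_zero],
        fun h' => hK0 ?_, by simp [IsHermitian, conjTranspose_smul, ← smul_neg]⟩
      have h2 := (smul_eq_zero.1 h').resolve_left Complex.I_ne_zero
      rw [← sub_eq_zero.1 h2, ← two_smul ℂ] at h
      exact (smul_eq_zero.1 h).resolve_left two_ne_zero
    · exact ⟨K + Kᴴ, by rw [map_add, hK, hK', add_zero], h, by simp [IsHermitian, add_comm]⟩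
  have hKt : K.trace = 0 := by rw [← hP.2, hK, trace_zero]
  have hline (X : M2) : ∃ l : ℂ, X - P X = l • K := by
    have h1 := (finrank_eq_one_iff_of_nonzero' (⟨K, hK⟩ : LinearMap.ker P)
      (fun h => hK0 (congrArg Subtype.val h))).1 hk ⟨X - P X, by
        rw [LinearMap.mem_ker, map_sub, hfix, sub_self]⟩
    obtain ⟨l, hl⟩ := h1
    exact ⟨l, (congrArg Subtype.val hl).symm⟩
  -- X - P X always lies in the line spanned by K; l records its coefficient for X = K E K, with E
  -- running over the matrix units.
  choose l hl using fun x : Fin 2 × Fin 2 => hline (K * single x.1 x.2 1 * K)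
  have hsq : K * K = -K.det • (1 : M2) := by
    have h11 : K 1 1 = - K 0 0 := by rw [trace_fin_two] at hKt; linear_combination hKt
    ext i j
    fin_cases i <;> fin_cases j <;>
      simp [Matrix.mul_apply, Fin.sum_univ_two, det_fin_two, h11] <;> ring
  have hcube : K * K * K = -K.det • K := by rw [hsq, Matrix.smul_mul, one_mul]
  have hsum (T : M2) : T = ∑ x : Fin 2 × Fin 2, T x.1 x.2 • single x.1 x.2 (1 : ℂ) := by
    conv_lhs => rw [matrix_eq_sum_single T]
    simp [Fintype.sum_prod_type, smul_single]
  -- By linearity the sum is the coefficient for X = K³. Since K² = -det K, this X is -det K times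
  -- K, which P kills.
  have hl' : ∑ x : Fin 2 × Fin 2, K x.1 x.2 * l x = -K.det := by
    have h1 : (∑ x : Fin 2 × Fin 2, K x.1 x.2 * l x) • K = -K.det • K := by
      have h2 : K * K * K = ∑ x : Fin 2 × Fin 2, K x.1 x.2 • (K * single x.1 x.2 1 * K) := by
        conv_lhs => rw [hsum K]
        rw [← hsum K]
        conv_lhs => enter [1, 2]; rw [hsum K]
        rw [Finset.mul_sum, Finset.sum_mul]
        refine Finset.sum_congr rfl fun x _ => ?_
        rw [Matrix.mul_smul, Matrix.smul_mul]
      have h3 : K * K * K - P (K * K * K) = (∑ x : Fin 2 × Fin 2, K x.1 x.2 * l x) • K := by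
        rw [h2, map_sum, ← Finset.sum_sub_distrib, Finset.sum_smul]
        refine Finset.sum_congr rfl fun x _ => ?_
        rw [map_smul, ← smul_sub, hl, smul_smul]
      rw [← h3, hcube, map_smul, hK, smul_zero, sub_zero]
    exact smul_left_injective _ hK0 h1
  -- Testing the Choi matrix on the entries of K gives (tr K)² + det K = det K ≥ 0, impossible for a
  -- nonzero traceless Hermitian K.
  have hpos := (hP.choi_posSemidef).dotProduct_mulVec_nonneg (fun x => K x.2 x.1)
  have hconj (i j : Fin 2) : star (K i j) = K j i := hKH.apply j i
  have hval : star (fun x : Fin 2 × Fin 2 => K x.2 x.1) ⬝ᵥ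
      (choi P *ᵥ fun x => K x.2 x.1) = K.det := by
    have h1 (x : Fin 2 × Fin 2) : K * single x.1 x.2 1 * K =
        ∑ y : Fin 2 × Fin 2, (K y.1 x.1 * K x.2 y.2) • single y.1 y.2 (1 : ℂ) := by
      conv_lhs => rw [hsum (K * single x.1 x.2 1 * K)]
      refine Finset.sum_congr rfl fun y _ => ?_
      congr 1
      simp [Matrix.mul_apply, single_apply, ite_and]
    have h2 (x : Fin 2 × Fin 2) : ∑ y : Fin 2 × Fin 2, (K y.1 x.1 * K x.2 y.2) *
        P (single y.1 y.2 1) x.1 x.2 = K x.1 x.1 * K x.2 x.2 - l x * K x.1 x.2 := by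
      have h3 := congrFun (congrFun (hl x) x.1) x.2
      rw [Matrix.sub_apply, Matrix.smul_apply, smul_eq_mul] at h3
      have h4 : (K * single x.1 x.2 (1 : ℂ) * K : M2) x.1 x.2 = K x.1 x.1 * K x.2 x.2 := by
        simp [Matrix.mul_apply, single_apply, ite_and]
      rw [← h3, h4, h1, map_sum, Matrix.sum_apply, sub_sub_cancel]
      simp only [map_smul, Matrix.smul_apply, smul_eq_mul]
    have h5 : ∑ x : Fin 2 × Fin 2, (K x.1 x.1 * K x.2 x.2 - l x * K x.1 x.2) = K.det := by
      rw [Finset.sum_sub_distrib]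
      have h6 : ∑ x : Fin 2 × Fin 2, l x * K x.1 x.2 = -K.det := by
        rw [← hl']; exact Finset.sum_congr rfl fun x _ => mul_comm _ _
      rw [h6]
      rw [trace_fin_two] at hKt
      simp only [Fintype.sum_prod_type, Fin.sum_univ_two]
      linear_combination (K 0 0 + K 1 1) * hKt
    rw [← h5, ← Finset.sum_congr rfl fun x _ => h2 x]
    simp only [dotProduct, mulVec, choi, of_apply, Pi.star_apply, hconj, Fintype.sum_prod_type,
      Fin.sum_univ_two]
    ring
  rw [hval] at hpos
  obtain ⟨h1, h2⟩ := isHermitian_det_nonpos_of_trace_eq_zero hKH hKt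
  exact hK0 (h2 (le_antisymm h1 (Complex.le_def.1 hpos).1))

/-- Positivity of the 2 × 2 principal minor gives |C i j|² ≤ C i i · C j j; this bounds the Choi
matrices of channels uniformly. -/
lemma norm_apply_le_trace {n : Type*} [Fintype n] [DecidableEq n] {C : Matrix n n ℂ}
    (hC : C.PosSemidef) (i j : n) : ‖C i j‖ ≤ C.trace.re := by
  have hd (i : n) := (Complex.le_def.1 (hC.diag_nonneg (i := i)))
  have hle (i : n) : (C i i).re ≤ C.trace.re := by
    rw [trace, Complex.re_sum]
    exact Finset.single_le_sum (f := fun i => (C i i).re) (fun i _ => (hd i).1) (Finset.mem_univ i)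
  have h := (Complex.le_def.1 (hC.submatrix ![i, j]).det_nonneg).1
  rw [det_fin_two] at h
  simp only [submatrix_apply, Matrix.cons_val_zero, Matrix.cons_val_one] at h
  rw [← hC.isHermitian.apply j i, Complex.star_def, Complex.mul_conj, Complex.sub_re,
    Complex.mul_re, ← (hd i).2, Complex.ofReal_re, Complex.normSq_eq_norm_sq] at h
  simp only [Complex.zero_re, Complex.zero_im, zero_mul, sub_zero] at h
  have h0 := (hd i).1
  have h1 := (hd j).1
  simp only [Complex.zero_re] at h0 h1
  refine abs_le_of_sq_le_sq' ?_ (h0.trans (hle i)) |>.2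
  nlinarith [mul_le_mul (hle i) (hle j) h1 (h0.trans (hle i))]

open scoped Matrix.Norms.L2Operator in
lemma isClosed_posSemidef {n : Type*} [Fintype n] [DecidableEq n] :
    IsClosed {A : Matrix n n ℂ | A.PosSemidef} := by
  have := CStarAlgebra.isClosed_nonneg (A := Matrix n n ℂ)
  simpa only [nonneg_iff_posSemidef] using this

/-- Channels are compact: along an ultrafilter they converge to a channel. -/
lemma exists_channel_limit {α : Type*} (U : Ultrafilter α) {V : α → M2 →ₗ[ℂ] M2}
    (hV : ∀ᶠ s in U, IsCPTP (V s)) :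
    ∃ P : M2 →ₗ[ℂ] M2, IsCPTP P ∧ ∀ (Y : α → M2) (Z : M2), Tendsto Y U (𝓝 Z) →
      Tendsto (fun s => V s (Y s)) U (𝓝 (P Z)) := by
  have hlim (x y : Fin 2 × Fin 2) : ∃ c, Tendsto (fun s => choi (V s) x y) U (𝓝 c) := by
    have hb : ∀ᶠ s in U, choi (V s) x y ∈ Metric.closedBall (0 : ℂ) 2 := by
      filter_upwards [hV] with s hs
      rw [mem_closedBall_zero_iff]
      refine (norm_apply_le_trace hs.choi_posSemidef x y).trans_eq ?_
      rw [choi_eq_ampliation, trace_ampliation hs.2]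
      simp only [trace, diag_apply, Fintype.sum_prod_type, Fin.sum_univ_two, choi, of_apply]
      simp
      norm_num
    obtain ⟨c, -, hc⟩ := (isCompact_closedBall (0 : ℂ) 2).ultrafilter_le_nhds
      (U.map fun s => choi (V s) x y) (le_principal_iff.2 hb)
    exact ⟨c, hc⟩
  choose c hc using hlim
  have hten : Tendsto (fun s => choi (V s)) U (𝓝 (of c)) :=
    tendsto_pi_nhds.2 fun x => tendsto_pi_nhds.2 fun y => hc x y
  have happ (Y : α → M2) (Z : M2) (hY : Tendsto Y U (𝓝 Z)) :
      Tendsto (fun s => V s (Y s)) U (𝓝 (ofChoi (of c) Z)) := by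
    refine tendsto_pi_nhds.2 fun a => tendsto_pi_nhds.2 fun b => ?_
    have h1 : (fun s => V s (Y s) a b) =
        fun s => ∑ i, ∑ j, Y s i j * choi (V s) (i, a) (j, b) := by
      funext s
      rw [← ofChoi_apply, ofChoi_choi]
    rw [h1, ofChoi_apply]
    refine tendsto_finsetSum _ fun i _ => tendsto_finsetSum _ fun j _ => ?_
    exact (tendsto_pi_nhds.1 (tendsto_pi_nhds.1 hY i) j).mul (hc _ _)
  refine ⟨ofChoi (of c), ⟨isCompletelyPositive_ofChoi ?_, fun X => ?_⟩, happ⟩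
  · exact isClosed_posSemidef.mem_of_tendsto hten (hV.mono fun s hs => hs.choi_posSemidef)
  · have h1 := (continuous_id.matrix_trace.tendsto _).comp (happ (fun _ => X) X tendsto_const_nhds)
    refine tendsto_nhds_unique h1 ?_
    exact tendsto_const_nhds.congr' (hV.mono fun s hs => (hs.2 X).symm)

end Limits

/-! ### Rank of a contractive evolution. -/

section Dynamics

/-- For injective `Φ` contractivity of the ampliation yields a channel `V` with `Ψ = V ∘ Φ`. -/
theorem exists_channel_of_injective {Φ Ψ : M2 →ₗ[ℂ] M2} (hΦ : IsCPTP Φ) (hΨ : IsCPTP Ψ)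
    (hinj : Function.Injective Φ)
    (h : ∀ X : Matrix (Fin 2 × Fin 2) (Fin 2 × Fin 2) ℂ, X.IsHermitian →
      traceNorm (ampliation (Fin 2) Ψ X) ≤ traceNorm (ampliation (Fin 2) Φ X)) :
    ∃ V : M2 →ₗ[ℂ] M2, IsCPTP V ∧ Ψ = V ∘ₗ Φ := by
  let e := LinearEquiv.ofInjectiveEndo Φ hinj
  have he (X : M2) : Φ (e.symm X) = X := e.apply_symm_apply X
  have he' (X : M2) : e.symm (Φ X) = X := e.symm_apply_apply X
  have hc : Φ ∘ₗ e.symm.toLinearMap = LinearMap.id := LinearMap.ext he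
  have hH (X : M2) : e.symm Xᴴ = (e.symm X)ᴴ := by
    apply hinj
    rw [he, hΦ.1.map_conjTranspose, he]
  refine ⟨Ψ ∘ₗ e.symm.toLinearMap, isCPTP_of_traceNorm_le (fun X => ?_) (fun X => ?_) ?_, ?_⟩
  · rw [LinearMap.comp_apply, hΨ.2, ← hΦ.2]
    exact congrArg trace (he X)
  · rw [LinearMap.comp_apply, LinearMap.comp_apply, ← hΨ.1.map_conjTranspose]
    exact congrArg Ψ (hH X)
  · rw [choi_eq_ampliation, ampliation_comp]
    -- Contractivity is applied to the preimage of the Choi matrix of the identity under the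
    -- ampliation of Φ, which need not be positive.
    refine (h _ (ampliation_isHermitian hH choi_id_posSemidef.isHermitian)).trans_eq ?_
    rw [← ampliation_comp, hc, ampliation_id]
  · ext1 X
    exact congrArg Ψ (he' X).symm

variable {Λ : ℝ → M2 →ₗ[ℂ] M2}

/-- The dimension of the image of a monotone evolution drops from four to at most two. -/
theorem finrank_range_ne_three_of_injective_before (hΛ : IsQubitDynamicalMap Λ) {t : ℝ}
    (ht : 0 < t) (hinj : ∀ s, 0 ≤ s → s < t → Function.Injective (Λ s))
    (h : ∀ s, 0 ≤ s → s < t → ∃ V : M2 →ₗ[ℂ] M2, IsCPTP V ∧ Λ t = V ∘ₗ Λ s) :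
    Module.finrank ℂ (LinearMap.range (Λ t)) ≠ 3 := by
  have hne : (𝓝[Set.Ico 0 t] t).NeBot := by
    rw [← mem_closure_iff_nhdsWithin_neBot, closure_Ico ht.ne]
    exact Set.right_mem_Icc.2 ht.le
  let U : Ultrafilter ℝ := Ultrafilter.of (𝓝[Set.Ico 0 t] t)
  have hU : (U : Filter ℝ) ≤ 𝓝[Set.Ico 0 t] t := Ultrafilter.of_le _
  have hUs : ∀ᶠ s in (U : Filter ℝ), s ∈ Set.Ico 0 t := hU self_mem_nhdsWithin
  have h' : ∀ s, ∃ V : M2 →ₗ[ℂ] M2, s ∈ Set.Ico 0 t → IsCPTP V ∧ Λ t = V ∘ₗ Λ s := by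
    intro s
    by_cases hs : s ∈ Set.Ico 0 t
    · obtain ⟨V, hV⟩ := h s hs.1 hs.2
      exact ⟨V, fun _ => hV⟩
    · exact ⟨0, fun h => absurd h hs⟩
  choose V hV using h'
  obtain ⟨P, hP, hlim⟩ := exists_channel_limit U (hUs.mono fun s hs => (hV s hs).1)
  -- Λ t X = V s (Λ s X) for every s < t, and Λ s X tends to Λ t X.
  have hfix (X : M2) : P (Λ t X) = Λ t X := by
    have h1 : Tendsto (fun s => Λ s X) U (𝓝 (Λ t X)) :=
      (((hΛ.cont X) t ht.le).mono Set.Ico_subset_Ici_self).mono_left hU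
    refine tendsto_nhds_unique (hlim _ _ h1) ?_
    exact tendsto_const_nhds.congr' (hUs.mono fun s hs => by
      conv_lhs => rw [(hV s hs).2]
      rfl)
  -- Λ s is surjective for s < t, so the range of each V s lies in that of Λ t, which is closed.
  have hran (X : M2) : P X ∈ LinearMap.range (Λ t) := by
    have hcl : IsClosed (LinearMap.range (Λ t) : Set M2) :=
      Submodule.closed_of_finiteDimensional _
    refine hcl.mem_of_tendsto (hlim (fun _ => X) X tendsto_const_nhds) (hUs.mono fun s hs => ?_)
    obtain ⟨Y, rfl⟩ := (LinearMap.injective_iff_surjective.1 (hinj s hs.1 hs.2)) X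
    refine ⟨Y, ?_⟩
    rw [(hV s hs).2]
    rfl
  have heq : LinearMap.range P = LinearMap.range (Λ t) := by
    apply le_antisymm
    · rintro _ ⟨X, rfl⟩
      exact hran X
    · rintro _ ⟨X, rfl⟩
      exact ⟨Λ t X, hfix X⟩
  rw [← heq]
  refine finrank_range_ne_three hP fun X => ?_
  obtain ⟨Y, hY⟩ := hran X
  rw [← hY, hfix]

lemma continuousOn_det (hΛ : IsQubitDynamicalMap Λ) :
    ContinuousOn (fun t => LinearMap.det (Λ t)) (Set.Ici 0) := by
  let b := Matrix.stdBasis ℂ (Fin 2) (Fin 2)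
  have h1 : (fun t => LinearMap.det (Λ t)) = fun t => (LinearMap.toMatrix b b (Λ t)).det := by
    funext t
    exact (LinearMap.det_toMatrix b _).symm
  rw [h1]
  have h2 : ContinuousOn (fun t => LinearMap.toMatrix b b (Λ t)) (Set.Ici 0) := by
    refine continuousOn_pi.2 fun x => continuousOn_pi.2 fun y => ?_
    simp only [LinearMap.toMatrix_apply]
    have h3 : Continuous fun X : M2 => b.repr X x :=
      LinearMap.continuous_of_finiteDimensional (b.coord x)
    exact h3.comp_continuousOn (hΛ.cont (b y))
  exact (continuous_id.matrix_det).comp_continuousOn h2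

/-- If the ampliated evolution contracts the trace norm, a noninvertible `Λ s` has an image of
dimension at most two. -/
theorem finrank_range_le_two (hΛ : IsQubitDynamicalMap Λ)
    (h : ∀ s t, 0 ≤ s → s ≤ t → ∀ X : Matrix (Fin 2 × Fin 2) (Fin 2 × Fin 2) ℂ, X.IsHermitian →
      traceNorm (ampliation (Fin 2) (Λ t) X) ≤ traceNorm (ampliation (Fin 2) (Λ s) X))
    (hker : ∀ s t, 0 ≤ s → s ≤ t → LinearMap.ker (Λ s) ≤ LinearMap.ker (Λ t))
    {s : ℝ} (hs : 0 ≤ s) (hn : ¬ Function.Injective (Λ s)) :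
    Module.finrank ℂ (LinearMap.range (Λ s)) ≤ 2 := by
  have hdet (t : ℝ) : LinearMap.det (Λ t) = 0 ↔ ¬ Function.Injective (Λ t) := by
    rw [← LinearMap.ker_eq_bot, ← LinearMap.isUnit_iff_ker_eq_bot, LinearMap.isUnit_iff_isUnit_det,
      isUnit_iff_ne_zero, not_not]
  -- Continuity of the determinant makes N closed, so its infimum is an actual first noninjective
  -- time; it is positive because Λ 0 is the identity.
  let N : Set ℝ := Set.Icc 0 s ∩ (fun t => LinearMap.det (Λ t)) ⁻¹' {0}
  have hN : IsClosed N :=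
    ((continuousOn_det hΛ).mono Set.Icc_subset_Ici_self).preimage_isClosed_of_isClosed
      isClosed_Icc isClosed_singleton
  have hsN : s ∈ N := ⟨⟨hs, le_rfl⟩, (hdet s).2 hn⟩
  have hbdd : BddBelow N := ⟨0, fun t ht => ht.1.1⟩
  have htN : sInf N ∈ N := hN.csInf_mem ⟨s, hsN⟩ hbdd
  set t := sInf N with ht
  have hinj : ∀ r, 0 ≤ r → r < t → Function.Injective (Λ r) := by
    intro r hr hrt
    by_contra hc
    exact (notMem_of_lt_csInf hrt hbdd) ⟨⟨hr, (hrt.trans_le htN.1.2).le⟩, (hdet r).2 hc⟩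
  have hnt : ¬ Function.Injective (Λ t) := (hdet t).1 htN.2
  have ht0 : 0 < t := by
    refine lt_of_le_of_ne htN.1.1 fun h0 => hnt ?_
    rw [← h0, hΛ.init]
    exact Function.injective_id
  have h3 := finrank_range_ne_three_of_injective_before hΛ ht0 hinj fun r hr hrt =>
    exists_channel_of_injective (hΛ.cptp r hr) (hΛ.cptp t ht0.le) (hinj r hr hrt)
      (h r t hr hrt.le)
  have hfr (r : ℝ) := LinearMap.finrank_range_add_finrank_ker (Λ r)
  simp only [Module.finrank_matrix, Fintype.card_fin, Module.finrank_self] at hfr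
  have hk1 : 0 < Module.finrank ℂ (LinearMap.ker (Λ t)) := by
    rw [Module.finrank_pos_iff, Submodule.nontrivial_iff_ne_bot]
    exact fun h => hnt (LinearMap.ker_eq_bot.1 h)
  have hk2 := Submodule.finrank_mono (hker t s ht0.le htN.1.2)
  have := hfr t
  have := hfr s
  omega

end Dynamics
end QubitEvolution

namespace QubitEvolution
open Matrix Filter
open scoped Kronecker Topology

/-! ### From forward derivatives to contractivity and divisibility. -/

section Monotonicity

lemma forwardDeriv_nonpos {f : ℝ → ℝ} {t : ℝ} (h : ∀ s, t ≤ s → f s ≤ f t) :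
    forwardDeriv f t ≤ 0 := by
  refine Filter.limsup_le_of_le (h := ?_)
  filter_upwards [self_mem_nhdsWithin] with u hu
  have hu : 0 < u := hu
  exact_mod_cast div_nonpos_of_nonpos_of_nonneg (sub_nonpos.2 (h _ (by linarith))) hu.le

/-- A continuous function whose upper forward derivative is nonpositive is nonincreasing. -/
theorem le_of_forwardDeriv_nonpos {f : ℝ → ℝ} (hf : ContinuousOn f (Set.Ici 0))
    (h : ∀ t, 0 ≤ t → forwardDeriv f t ≤ 0) {s t : ℝ} (hs : 0 ≤ s) (hst : s ≤ t) : f t ≤ f s := by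
  -- Comparison with the constant f s: this needs right slopes below each r > 0 only frequently,
  -- while the limsup bound gives it eventually.
  refine image_le_of_liminf_slope_right_le_deriv_boundary (f := f) (a := s) (b := t)
    (B := fun _ => f s) (B' := fun _ => 0) (hf.mono fun x hx => hs.trans hx.1) le_rfl
    continuousOn_const (fun x _ => hasDerivWithinAt_const _ _ _) (fun x hx r hr => ?_)
    (Set.right_mem_Icc.2 hst)
  have h1 : forwardDeriv f x < (r : EReal) :=
    (h x (hs.trans hx.1)).trans_lt (by exact_mod_cast hr)
  have h2 := eventually_lt_of_limsup_lt h1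
  have h3 : Tendsto (fun z => z - x) (𝓝[>] x) (𝓝[>] 0) := by
    refine tendsto_nhdsWithin_of_tendsto_nhds_of_eventually_within _ ?_ ?_
    · have : Tendsto (fun z => z - x) (𝓝 x) (𝓝 (x - x)) := (continuous_sub_right x).tendsto x
      rw [sub_self] at this
      exact this.mono_left nhdsWithin_le_nhds
    · filter_upwards [self_mem_nhdsWithin] with z hz
      exact sub_pos.2 (Set.mem_Ioi.1 hz)
  refine Eventually.frequently ?_
  filter_upwards [h3.eventually h2] with z hz
  rw [add_sub_cancel] at hz
  rw [slope_def_field]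
  exact_mod_cast hz

/-- Normalising the two Jordan parts turns their traces into weights; r is the sum of these traces,
and r = 0 leaves the weights arbitrary. -/
lemma exists_density_decomposition {X : Matrix (Fin 2 × Fin 2) (Fin 2 × Fin 2) ℂ}
    (hX : X.IsHermitian) : ∃ (r p₁ p₂ : ℝ) (ρ₁ ρ₂ : Matrix (Fin 2 × Fin 2) (Fin 2 × Fin 2) ℂ),
      0 ≤ r ∧ 0 ≤ p₁ ∧ 0 ≤ p₂ ∧ p₁ + p₂ = 1 ∧ IsDensity ρ₁ ∧ IsDensity ρ₂ ∧
        X = (r : ℂ) • ((p₁ : ℂ) • ρ₁ - (p₂ : ℂ) • ρ₂) := by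
  have key (P : Matrix (Fin 2 × Fin 2) (Fin 2 × Fin 2) ℂ) (hP : P.PosSemidef) :
      ∃ (a : ℝ) (ρ : Matrix (Fin 2 × Fin 2) (Fin 2 × Fin 2) ℂ), 0 ≤ a ∧ IsDensity ρ ∧
        P = (a : ℂ) • ρ := by
    by_cases h0 : P.trace = 0
    · refine ⟨0, single 0 0 1, le_rfl, ⟨?_, by simp⟩, by simp [hP.trace_eq_zero_iff.1 h0]⟩
      have := posSemidef_vecMulVec_self_star (Pi.single (0 : Fin 2 × Fin 2) (1 : ℂ))
      rwa [← Pi.single_star, star_one, ← single_eq_single_vecMulVec_single] at this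
    · have h1 := Complex.le_def.1 hP.trace_nonneg
      have h2 : P.trace = (P.trace.re : ℂ) := Complex.ext rfl h1.2.symm
      refine ⟨P.trace.re, P.trace⁻¹ • P, h1.1, ⟨hP.smul (inv_nonneg.2 hP.trace_nonneg), ?_⟩, ?_⟩
      · rw [trace_smul, smul_eq_mul, inv_mul_cancel₀ h0]
      · rw [← h2, smul_smul, mul_inv_cancel₀ h0, one_smul]
  obtain ⟨P, Q, hP, hQ, rfl, -⟩ := exists_jordan hX
  obtain ⟨a, ρ₁, ha, hρ₁, rfl⟩ := key P hP
  obtain ⟨b, ρ₂, hb, hρ₂, rfl⟩ := key Q hQ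
  by_cases h0 : a + b = 0
  · have ha0 : a = 0 := by linarith
    have hb0 : b = 0 := by linarith
    exact ⟨0, 1, 0, ρ₁, ρ₂, le_rfl, zero_le_one, le_rfl, by norm_num, hρ₁, hρ₂, by
      simp [ha0, hb0]⟩
  · refine ⟨a + b, a / (a + b), b / (a + b), ρ₁, ρ₂, add_nonneg ha hb,
      div_nonneg ha (add_nonneg ha hb), div_nonneg hb (add_nonneg ha hb), by field_simp, hρ₁, hρ₂,
      ?_⟩
    rw [smul_sub, smul_smul, smul_smul, ← Complex.ofReal_mul, ← Complex.ofReal_mul,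
      mul_div_cancel₀ _ h0, mul_div_cancel₀ _ h0]

lemma isHermitian_density_sub {n : Type*} [Fintype n] {ρ₁ ρ₂ : Matrix n n ℂ} (h₁ : IsDensity ρ₁)
    (h₂ : IsDensity ρ₂) (p₁ p₂ : ℝ) : ((p₁ : ℂ) • ρ₁ - (p₂ : ℂ) • ρ₂).IsHermitian := by
  rw [IsHermitian, conjTranspose_sub, conjTranspose_smul, conjTranspose_smul,
    h₁.1.isHermitian.eq, h₂.1.isHermitian.eq, Complex.star_def, Complex.conj_ofReal,
    Complex.conj_ofReal]

variable {Λ : ℝ → M2 →ₗ[ℂ] M2}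

lemma continuousOn_traceNorm_ampliation (hΛ : IsQubitDynamicalMap Λ)
    {X : Matrix (Fin 2 × Fin 2) (Fin 2 × Fin 2) ℂ} (hX : X.IsHermitian) :
    ContinuousOn (fun t => traceNorm (ampliation (Fin 2) (Λ t) X)) (Set.Ici 0) := by
  have h1 : ContinuousOn (fun t => ampliation (Fin 2) (Λ t) X) (Set.Ici 0) := by
    refine continuousOn_pi.2 fun x => continuousOn_pi.2 fun y => ?_
    have h2 := hΛ.cont (of fun a b => X (x.1, a) (y.1, b))
    exact continuousOn_pi.1 (continuousOn_pi.1 h2 x.2) y.2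
  refine (continuous_trace_abs.comp_continuousOn h1).congr fun t ht => ?_
  exact traceNorm_eq_abs (ampliation_isHermitian (hΛ.cptp t ht).1.map_conjTranspose hX)

/-- If the ampliated evolution contracts the trace norm, the evolution is CP-divisible. -/
theorem isCPDivisible_of_contractive (hΛ : IsQubitDynamicalMap Λ)
    (h : ∀ s t, 0 ≤ s → s ≤ t → ∀ X : Matrix (Fin 2 × Fin 2) (Fin 2 × Fin 2) ℂ, X.IsHermitian →
      traceNorm (ampliation (Fin 2) (Λ t) X) ≤ traceNorm (ampliation (Fin 2) (Λ s) X)) :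
    IsCPDivisible Λ := by
  have h' (s t : ℝ) (hs : 0 ≤ s) (hst : s ≤ t) (X : M2) (hX : X.IsHermitian) :
      traceNorm (Λ t X) ≤ traceNorm (Λ s X) := by
    have h1 : (single (0 : Fin 2) 0 (1 : ℂ) ⊗ₖ X).IsHermitian := by
      rw [IsHermitian, conjTranspose_kronecker, hX.eq]; simp
    have h2 := h s t hs hst _ h1
    rwa [ampliation_kronecker, ampliation_kronecker, traceNorm_single_kronecker,
      traceNorm_single_kronecker] at h2
  have hker (s t : ℝ) (hs : 0 ≤ s) (hst : s ≤ t) : LinearMap.ker (Λ s) ≤ LinearMap.ker (Λ t) :=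
    ker_le_of_traceNorm_le (hΛ.cptp s hs) (hΛ.cptp t (hs.trans hst)) (h' s t hs hst)
  intro s t hs hst
  by_cases hinj : Function.Injective (Λ s)
  · exact exists_channel_of_injective (hΛ.cptp s hs) (hΛ.cptp t (hs.trans hst)) hinj
      (h s t hs hst)
  · exact exists_channel_of_finrank_le_two (hΛ.cptp s hs) (hΛ.cptp t (hs.trans hst))
      (h' s t hs hst) (finrank_range_le_two hΛ h hker hs hinj)

end Monotonicity
end QubitEvolution

theorem theorem6 (Λ : ℝ → QubitEvolution.M2 →ₗ[ℂ] QubitEvolution.M2)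
    (hΛ : QubitEvolution.IsQubitDynamicalMap Λ) :
    QubitEvolution.IsCPDivisible Λ ↔
      ∀ (p₁ p₂ : ℝ), 0 ≤ p₁ → 0 ≤ p₂ → p₁ + p₂ = 1 →
        ∀ ϱ₁ ϱ₂ : Matrix (Fin 2 × Fin 2) (Fin 2 × Fin 2) ℂ,
          QubitEvolution.IsDensity ϱ₁ → QubitEvolution.IsDensity ϱ₂ →
            ∀ t : ℝ, 0 ≤ t →
              QubitEvolution.forwardDeriv
                (fun τ => QubitEvolution.traceNorm
                  (QubitEvolution.ampliation (Fin 2) (Λ τ) ((p₁ : ℂ) • ϱ₁ - (p₂ : ℂ) • ϱ₂))) t ≤ 0 := by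
  open QubitEvolution in
  constructor
  · intro hdiv p₁ p₂ _ _ _ ρ₁ ρ₂ h₁ h₂ t ht
    refine forwardDeriv_nonpos fun s hts => ?_
    obtain ⟨V, hV, hVs⟩ := hdiv t s ht hts
    simp only [hVs, ampliation_comp]
    exact hV.traceNorm_ampliation_le (ampliation_isHermitian
      (hΛ.cptp t ht).1.map_conjTranspose (isHermitian_density_sub h₁ h₂ p₁ p₂))
  · intro h
    refine isCPDivisible_of_contractive hΛ fun s t hs hst X hX => ?_
    obtain ⟨r, p₁, p₂, ρ₁, ρ₂, hr, hp₁, hp₂, hp, h₁, h₂, rfl⟩ := exists_density_decomposition hX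
    have hY := isHermitian_density_sub h₁ h₂ p₁ p₂
    have hle := le_of_forwardDeriv_nonpos (continuousOn_traceNorm_ampliation hΛ hY)
      (h p₁ p₂ hp₁ hp₂ hp ρ₁ ρ₂ h₁ h₂) hs hst
    have hH (u : ℝ) (hu : 0 ≤ u) :=
      ampliation_isHermitian (κ := Fin 2) (hΛ.cptp u hu).1.map_conjTranspose hY
    rw [ampliation_smul, ampliation_smul, traceNorm_smul (hH t (hs.trans hst)) hr,
      traceNorm_smul (hH s hs) hr]
    exact mul_le_mul_of_nonneg_left hle hr
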